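/- Let $k$ be a commutative Noetherian ring. A *Noetherian $k$-algebra* is an associative unital $k$-algebra $A$ which is finitely generated as a $k$-module. Put $A^e = A\otimes_k A^{\mathrm{op}}$, whose left modules are the $A$-bimodules on which $k$ acts centrally, and let $\mathrm{HH}^*(A)=\mathrm{Ext}^*_{A^e}(A,A)=\bigoplus_{n\ge 0}\mathrm{Ext}^n_{A^e}(A,A)$ be the Hochschild cohomology ring, with the Yoneda product. For every $A$-bimodule $X$, the Yoneda product makes $\mathrm{Ext}^*_{A^e}(A,X)=\bigoplus_{n\ge 0}\mathrm{Ext}^n_{A^e}(A,X)$ a right $\mathrm{HH}^*(A)$-module. We say that $A$ *satisfies* **Fgb** if $\mathrm{HH}^*(A)$ is a (left and right) Noetherian ring and $\mathrm{Ext}^*_{A^e}(A,X)$ is a finitely generated right $\mathrm{HH}^*(A)$-module for every finitely generated $A$-bimodule $X$. Let $A$ be a Noetherian $k$-algebra which is projective as a $k$-module, and let $G$ be a finite group acting on $A$ by $k$-algebra automorphisms, $a\mapsto {}^g a$. Let $A\rtimes G$ be the skew group algebra: the $k$-module $A\otimes_k kG$ with multiplication $(a\otimes g)(b\otimes h)=a({}^g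 b)\otimes gh$. **Theorem.** (1) If $A\rtimes G$ satisfies **Fgb**, then so does $A$. (2) Suppose that the order $|G|$ is invertible in $k$. Then $A$ satisfies **Fgb** if and only if $A\rtimes G$ does. -/

import Mathlib

open CategoryTheory MulOpposite
open scoped TensorProduct DirectSum

universe w v u

noncomputable section

/-! ### Total Ext groups with the Yoneda product -/

section Yoneda

variable {C : Type u} [Category.{v} C] [Abelian C] [HasExt.{w} C]

/-- The total Ext group `Ext^*(X, Y) = ⨁ n, Ext^n(X, Y)` of two objects of an abelian category. -/
def ExtStar (X Y : C) : Type w :=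
  ⨁ n : ℕ, Abelian.Ext.{w} X Y n

namespace ExtStar

instance (X Y : C) : AddCommGroup (ExtStar X Y) :=
  inferInstanceAs (AddCommGroup (⨁ n : ℕ, Abelian.Ext.{w} X Y n))

/-- The inclusion `Ext^n(X, Y) → Ext^*(X, Y)`. -/
def of (X Y : C) (n : ℕ) : Abelian.Ext.{w} X Y n →+ ExtStar X Y :=
  DirectSum.of (fun n : ℕ => Abelian.Ext.{w} X Y n) n

theorem hom_ext {X Y : C} {M : Type*} [AddCommMonoid M] {f g : ExtStar X Y →+ M}
    (h : ∀ (n : ℕ) (a : Abelian.Ext.{w} X Y n), f (of X Y n a) = g (of X Y n a)) : f = g :=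
  DirectSum.addHom_ext h

/-- The additive map out of `Ext^*(X, Y)` with prescribed homogeneous components. -/
def lift {X Y : C} {M : Type*} [AddCommMonoid M] (f : ∀ n : ℕ, Abelian.Ext.{w} X Y n →+ M) :
    ExtStar X Y →+ M :=
  DirectSum.toAddMonoid f

theorem lift_of {X Y : C} {M : Type*} [AddCommMonoid M]
    (f : ∀ n : ℕ, Abelian.Ext.{w} X Y n →+ M) (n : ℕ) (a : Abelian.Ext.{w} X Y n) :
    lift f (of X Y n a) = f n a :=
  DirectSum.toAddMonoid_of f n a

theorem of_congr {X Y Z : C} {a b c d : ℕ} (α : Abelian.Ext.{w} X Y a) (β : Abelian.Ext.{w} Y Z b)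
    (h : a + b = c) (h' : a + b = d) :
    of X Z c (α.comp β h) = of X Z d (α.comp β h') := by
  subst h; subst h'; rfl

/-- The Yoneda product `(θ, η) ↦ θ ∘ η`, written in the order of composition of maps: for `η` in
`Ext^m(X, Y)` and `θ` in `Ext^n(Y, Z)` it is the composite `X ⟶ Y[m] ⟶ Z[m + n]` in the derived
category. It is extended biadditively to the total Ext groups. -/
def yoneda (X Y Z : C) : ExtStar Y Z →+ ExtStar X Y →+ ExtStar X Z :=
  AddMonoidHom.flip <|
    lift fun m : ℕ => AddMonoidHom.flip <|
      lift fun n : ℕ => AddMonoidHom.flip <|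
        (AddMonoidHom.compHom (of X Z (m + n))).comp
          (Abelian.Ext.bilinearComp X Y Z m n (m + n) rfl)

@[simp]
theorem yoneda_of_of {X Y Z : C} {m n : ℕ} (θ : Abelian.Ext.{w} Y Z n)
    (η : Abelian.Ext.{w} X Y m) :
    yoneda X Y Z (of Y Z n θ) (of X Y m η) = of X Z (m + n) (η.comp θ rfl) := by
  rw [yoneda, AddMonoidHom.flip_apply, lift_of, AddMonoidHom.flip_apply, lift_of]
  rfl

theorem yoneda_assoc {W X Y Z : C} (c : ExtStar Y Z) (b : ExtStar X Y) (a : ExtStar W X) :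
    yoneda W X Z (yoneda X Y Z c b) a = yoneda W Y Z c (yoneda W X Y b a) := by
  let L : ExtStar Y Z →+ ExtStar X Y →+ ExtStar W X →+ ExtStar W Z :=
    (AddMonoidHom.compHom (yoneda W X Z)).comp (yoneda X Y Z)
  let R : ExtStar Y Z →+ ExtStar X Y →+ ExtStar W X →+ ExtStar W Z :=
    ((AddMonoidHom.compHom (M := ExtStar X Y)).flip (yoneda W X Y)).comp
      ((AddMonoidHom.compHom (M := ExtStar W X)).comp (yoneda W Y Z))
  have h : L = R := by
    refine hom_ext fun p γ => hom_ext fun n β => hom_ext fun m α => ?_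
    change yoneda W X Z (yoneda X Y Z (of Y Z p γ) (of X Y n β)) (of W X m α) =
      yoneda W Y Z (of Y Z p γ) (yoneda W X Y (of X Y n β) (of W X m α))
    simp only [yoneda_of_of]
    rw [of_congr α (β.comp γ rfl) rfl (Nat.add_assoc m n p).symm,
      ← Abelian.Ext.comp_assoc α β γ rfl rfl rfl]
  exact DFunLike.congr_fun (DFunLike.congr_fun (DFunLike.congr_fun h c) b) a

/-- The identity of `X`, as an element of degree `0` of `Ext^*(X, X)`. -/
def idElem (X : C) : ExtStar X X :=
  of X X 0 (Abelian.Ext.mk₀ (𝟙 X))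

theorem yoneda_id {X Y : C} (a : ExtStar X Y) : yoneda X X Y a (idElem X) = a := by
  have h : (yoneda X X Y).flip (idElem X) = AddMonoidHom.id _ := by
    refine hom_ext fun n α => ?_
    rw [AddMonoidHom.flip_apply, idElem, yoneda_of_of, AddMonoidHom.id_apply,
      of_congr _ _ rfl (zero_add n), Abelian.Ext.mk₀_id_comp]
  exact DFunLike.congr_fun h a

theorem id_yoneda {X Y : C} (a : ExtStar X Y) : yoneda X Y Y (idElem Y) a = a := by
  have h : yoneda X Y Y (idElem Y) = AddMonoidHom.id _ := by
    refine hom_ext fun n α => ?_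
    rw [idElem, yoneda_of_of, AddMonoidHom.id_apply, Abelian.Ext.comp_mk₀_id]
    rfl
  exact DFunLike.congr_fun h a

/-- `Ext^*(X, X)` is a ring under the Yoneda product. -/
instance (X : C) : Ring (ExtStar X X) where
  __ := (inferInstance : AddCommGroup (ExtStar X X))
  mul a b := yoneda X X X a b
  one := idElem X
  mul_assoc a b c := yoneda_assoc a b c
  one_mul a := id_yoneda a
  mul_one a := yoneda_id a
  left_distrib a b c := map_add (yoneda X X X a) b c
  right_distrib a b c := DFunLike.congr_fun (map_add (yoneda X X X) a b) c
  zero_mul a := DFunLike.congr_fun (map_zero (yoneda X X X)) a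
  mul_zero a := map_zero (yoneda X X X a)

/-- `Ext^*(X, Y)` is a right module over `Ext^*(X, X)` under the Yoneda product. -/
instance (X Y : C) : Module (ExtStar X X)ᵐᵒᵖ (ExtStar X Y) where
  smul r a := yoneda X X Y a r.unop
  one_smul a := yoneda_id a
  mul_smul r s a := (yoneda_assoc a s.unop r.unop).symm
  smul_zero r := DFunLike.congr_fun (map_zero (yoneda X X Y)) r.unop
  smul_add r a b := DFunLike.congr_fun (map_add (yoneda X X Y) a b) r.unop
  add_smul r s a := map_add (yoneda X X Y a) r.unop s.unop
  zero_smul a := map_zero (yoneda X X Y a)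

end ExtStar

end Yoneda

/-! ### Hochschild cohomology and the finiteness condition -/

section Hochschild

variable (k : Type v) [CommRing k] (A : Type u) [Ring A] [Algebra k A]

/-- The enveloping algebra `A ⊗ Aᵒᵖ` of a `k`-algebra `A`. Its left modules are the `A`-bimodules
on which `k` acts centrally. -/
abbrev EnvelopingAlgebra : Type u := A ⊗[k] Aᵐᵒᵖ

/-- The algebra `A` as a bimodule over itself, `(a ⊗ b) • x = a * x * b`. -/
def regularBimodule : ModuleCat.{u} (EnvelopingAlgebra k A) :=
  letI : Module (EnvelopingAlgebra k A) A := instModuleTensorProductMop k A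
  ModuleCat.of (EnvelopingAlgebra k A) A

/-- The Hochschild cohomology ring `Ext^*(A, A)`, taken over the enveloping algebra, with the
Yoneda product. -/
abbrev HochschildCohomology : Type u :=
  ExtStar (regularBimodule k A) (regularBimodule k A)

/-- The condition **Fgb** for a `k`-algebra `A`: the Hochschild cohomology ring is (left and right)
Noetherian, and for every finitely generated `A`-bimodule `X` the total group `Ext^*(A, X)` over
the enveloping algebra is a finitely generated right module over the Hochschild cohomology ring. -/
structure Fgb : Prop where
  left_noetherian : IsNoetherianRing (HochschildCohomology k A)
  right_noetherian : IsNoetherianRing (HochschildCohomology k A)ᵐᵒᵖ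
  ext_finite : ∀ X : ModuleCat.{u} (EnvelopingAlgebra k A),
    Module.Finite (EnvelopingAlgebra k A) X →
      Module.Finite (HochschildCohomology k A)ᵐᵒᵖ (ExtStar (regularBimodule k A) X)

end Hochschild

end

/-!
# Finite generation of Hochschild cohomology and skew group algebras

Write `B = A ⋊ G` and let `Δ = (A ⊗ Aᵐᵒᵖ) ⋊ G` be the skew group algebra of the diagonal action, so
that `A` itself is a `Δ`-module. The ring `Δ` mediates between the bimodules over `A` and those over
`B`: the ring homomorphisms `A ⊗ Aᵐᵒᵖ → Δ` and `Δ → B ⊗ Bᵐᵒᵖ`, where `g ∈ G` goes to `g ⊗ g⁻¹`,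
induce the regular bimodule of `A` by restriction from `A`, and that of `B` by induction from `A`.

For `X` and `Y` in an abelian category, call `Ext^*(X, Y)` Noetherian if it is so as a right module
over `Ext^*(X, X)`. There are two transfer principles, for exact functors `F : C ⥤ D` and
`U : D ⥤ C` and a category with enough projectives.

* If the identity of `C` is a retract of `F ⋙ U`, then `Ext^*(X, Y)` is Noetherian as soon as
  `Ext^*(F X, F Y)` is (`ExtStar.IsNoeth.of_retract`).
* If `F` is left adjoint to `U`, then `Ext^*(F X, Y)` is Noetherian as soon as `Ext^*(X, U Y)` is
  (`ExtStar.IsNoeth.of_adjunction`).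

Both follow from one statement on submodules, `isNoetherian_of_retract`. They apply to induction and
restriction between `Δ` and `B ⊗ Bᵐᵒᵖ`, where the identity is a direct summand of restriction after
induction, and to restriction and coinduction between `Δ` and `A ⊗ Aᵐᵒᵖ`, where the identity is a
direct summand of coinduction after restriction if `|G|` is invertible. Since all rings involved are
finite over `k`, the four functors preserve finite generation. Consequently the Noetherian property
of `Ext^*` from `A` over `Δ` is equivalent to that for `B` (`fgb_skew_iff_diagonalFiniteness`),
implies that for `A` (`fgb_of_diagonalFiniteness`), and follows from it when `|G|` is invertible
(`diagonalFiniteness_of_fgb`).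

It remains to see that **Fgb** for `A` amounts to `Ext^*(A, X)` being a Noetherian right module for
all finitely generated bimodules `X` (`fgb_iff_isNoeth`). The only part of **Fgb** which is not
contained in this is the left Noetherian property of the Hochschild cohomology ring. As `A` is
projective over `k`, this ring is graded commutative (`hochschild_gradedCommutative`), and a graded
commutative ring is isomorphic to its opposite (`ExtStar.equivOpposite`). Graded commutativity is
obtained by comparing, for a class `x` in `Ext^m(A, A)` and a left projective bimodule `W`, the
class `x ⊗_A W` with `x` under precomposition with classes in `Ext^n(W, A)`. The comparison is by
dimension shifting in `W`, each step of which contributes the sign `(-1) ^ m` of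
`Ext.mapExactFunctor_comp_extClass`.
-/


noncomputable section

/-! ### Naturality of Ext under exact functors -/

section ExtNaturality

open Limits Abelian

universe w₁ w₂ w₃ v₁ v₂ v₃ u₁ u₂ u₃

variable {C : Type u₁} [Category.{v₁} C] [Abelian C] [HasExt.{w₁} C]
variable {D : Type u₂} [Category.{v₂} D] [Abelian D] [HasExt.{w₂} D]
variable {E : Type u₃} [Category.{v₃} E] [Abelian E] [HasExt.{w₃} E]

/-- With enough projectives, every extension class is a Yoneda product of a morphism and classes of
short exact sequences. -/
theorem CategoryTheory.Abelian.Ext.induction_of_enoughProjectives [EnoughProjectives C]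
    {P : ∀ ⦃X Y : C⦄ ⦃n : ℕ⦄, Ext.{w₁} X Y n → Prop}
    (mk₀ : ∀ {X Y : C} (f : X ⟶ Y), P (Ext.mk₀ f))
    (extClass : ∀ {S : ShortComplex C} (hS : S.ShortExact), P hS.extClass)
    (comp : ∀ {X Y Z : C} {a b c : ℕ} (α : Ext.{w₁} X Y a) (β : Ext.{w₁} Y Z b) (h : a + b = c),
      P α → P β → P (α.comp β h))
    {X Y : C} {n : ℕ} (x : Ext.{w₁} X Y n) : P x := by
  induction n generalizing X Y with
  | zero =>
    obtain ⟨f, rfl⟩ := (Ext.mk₀_bijective X Y).2 x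
    exact mk₀ f
  | succ n ih =>
    let S := ShortComplex.mk _ _ (kernel.condition (Projective.π X))
    have hS : S.ShortExact :=
      { exact := ShortComplex.exact_of_f_is_kernel _ (kernelIsKernel S.g) }
    have : Projective S.X₂ := by dsimp [S]; infer_instance
    obtain ⟨y, rfl⟩ := Ext.contravariant_sequence_exact₃ hS Y x (Ext.eq_zero_of_projective _)
      (add_comm 1 n)
    exact comp _ _ _ (extClass hS) (ih y)

variable (F F' F'' : C ⥤ D)
  [F.Additive] [PreservesFiniteLimits F] [PreservesFiniteColimits F]
  [F'.Additive] [PreservesFiniteLimits F'] [PreservesFiniteColimits F']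
  [F''.Additive] [PreservesFiniteLimits F''] [PreservesFiniteColimits F'']
  (G : D ⥤ E) [G.Additive] [PreservesFiniteLimits G] [PreservesFiniteColimits G]

namespace CategoryTheory.Abelian.Ext

theorem comp_zsmul {X Y Z : C} {a b c : ℕ} (α : Ext.{w₁} X Y a) (β : Ext.{w₁} Y Z b)
    (h : a + b = c) (m : ℤ) : α.comp (m • β) h = m • α.comp β h :=
  map_zsmul (bilinearComp X Y Z a b c h α) m β

theorem zsmul_comp {X Y Z : C} {a b c : ℕ} (α : Ext.{w₁} X Y a) (β : Ext.{w₁} Y Z b)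
    (h : a + b = c) (m : ℤ) : (m • α).comp β h = m • α.comp β h :=
  map_zsmul ((bilinearComp X Y Z a b c h).flip β) m α

theorem mapExactFunctor_id [EnoughProjectives C] {X Y : C} {n : ℕ} (x : Ext.{w₁} X Y n) :
    x.mapExactFunctor (𝟭 C) = x := by
  induction x using induction_of_enoughProjectives with
  | mk₀ f => exact mapExactFunctor_mk₀ _ f
  | extClass hS => exact mapExactFunctor_extClass _ hS
  | comp α β h hα hβ => rw [mapExactFunctor_comp, hα, hβ]

theorem mapExactFunctor_mapExactFunctor [EnoughProjectives C] {X Y : C} {n : ℕ}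
    (x : Ext.{w₁} X Y n) :
    (x.mapExactFunctor F : Ext.{w₂} _ _ n).mapExactFunctor G =
      (x.mapExactFunctor (F ⋙ G) : Ext.{w₃} _ _ n) := by
  induction x using induction_of_enoughProjectives with
  | mk₀ f => simp only [mapExactFunctor_mk₀]; rfl
  | extClass hS =>
    rw [mapExactFunctor_extClass, mapExactFunctor_extClass]
    exact mapExactFunctor_extClass G (hS.map_of_exact F)
  | comp α β h hα hβ => simp only [mapExactFunctor_comp, hα, hβ]

variable {F F' F''}

theorem mapExactFunctor_naturality [EnoughProjectives C] (τ : F ⟶ F') {X Y : C} {n : ℕ}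
    (x : Ext.{w₁} X Y n) :
    (x.mapExactFunctor F : Ext.{w₂} _ _ n).comp (mk₀ (τ.app Y)) (add_zero n) =
      (mk₀ (τ.app X)).comp (x.mapExactFunctor F') (zero_add n) := by
  induction x using induction_of_enoughProjectives with
  | mk₀ f => simp only [mapExactFunctor_mk₀, mk₀_comp_mk₀, τ.naturality]
  | @extClass S hS =>
    simp only [mapExactFunctor_extClass]
    exact ShortComplex.ShortExact.extClass_naturality (hS.map_of_exact F) (hS.map_of_exact F')
      (S.mapNatTrans τ)
  | @comp X Y Z a b c α β h hα hβ =>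
    rw [mapExactFunctor_comp, mapExactFunctor_comp, comp_assoc_of_third_deg_zero, hβ,
      ← comp_assoc_of_second_deg_zero, hα, comp_assoc _ _ _ (zero_add a) h (by lia)]

end CategoryTheory.Abelian.Ext

/-- The short exact sequence obtained by pulling back along a map to the third term. -/
theorem CategoryTheory.ShortComplex.ShortExact.pullback
    {𝒜 : Type*} [Category* 𝒜] [Abelian 𝒜] {A B X K : 𝒜} {f : A ⟶ B} {g : B ⟶ X}
    {w : f ≫ g = 0} (hS : (ShortComplex.mk f g w).ShortExact) (a : K ⟶ X) :
    (ShortComplex.mk (pullback.lift 0 f (by simp [w])) (pullback.fst a g)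
      (pullback.lift_fst _ _ _) :
      ShortComplex 𝒜).ShortExact := by
  have : Epi g := hS.epi_g
  have : Mono f := hS.mono_f
  refine { exact := ShortComplex.exact_of_f_is_kernel _ ?_, mono_f := ?_, epi_g := ?_ }
  · have key : ∀ {W : 𝒜} (k : W ⟶ Limits.pullback a g) (_ : k ≫ pullback.fst a g = 0),
        (k ≫ pullback.snd a g) ≫ g = 0 := fun k hk => by
      rw [Category.assoc, ← pullback.condition, reassoc_of% hk, zero_comp]
    have hm : Mono (pullback.lift (0 : A ⟶ K) f (by simp [w]) : A ⟶ Limits.pullback a g) :=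
      ⟨fun g₁ g₂ e => by
        have := e =≫ pullback.snd a g
        simpa only [Category.assoc, pullback.lift_snd, cancel_mono] using this⟩
    refine KernelFork.IsLimit.ofι' _ _ fun {W} k hk =>
      ⟨hS.exact.lift (k ≫ pullback.snd a g) (key k hk), ?_⟩
    have := hS.exact.lift_f (k ≫ pullback.snd a g) (key k hk)
    apply pullback.hom_ext
    · rw [Category.assoc, pullback.lift_fst, comp_zero, hk]
    · simpa only [Category.assoc, pullback.lift_snd] using this
  · exact ⟨fun g₁ g₂ e => by
        have := e =≫ pullback.snd a g
        simpa only [Category.assoc, pullback.lift_snd, cancel_mono] using this⟩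
  · dsimp; infer_instance

/-- In a commutative diagram with short exact outer rows `A`, `C` and short exact columns, the two
ways of composing the connecting classes differ by a sign. The middle row need not be exact. -/
theorem CategoryTheory.ShortComplex.ShortExact.extClass_comp_extClass_eq_neg
    {A₁ A₂ A₃ B₁ B₂ B₃ C₁ C₂ C₃ : C}
    {fA : A₁ ⟶ A₂} {gA : A₂ ⟶ A₃} {wA : fA ≫ gA = 0} (hA : (ShortComplex.mk fA gA wA).ShortExact)
    {fB : B₁ ⟶ B₂} {gB : B₂ ⟶ B₃} (wB : fB ≫ gB = 0)
    {fC : C₁ ⟶ C₂} {gC : C₂ ⟶ C₃} {wC : fC ≫ gC = 0} (hC : (ShortComplex.mk fC gC wC).ShortExact)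
    {i₁ : A₁ ⟶ B₁} {p₁ : B₁ ⟶ C₁} {w₁ : i₁ ≫ p₁ = 0} (h₁ : (ShortComplex.mk i₁ p₁ w₁).ShortExact)
    {i₂ : A₂ ⟶ B₂} {p₂ : B₂ ⟶ C₂} {w₂ : i₂ ≫ p₂ = 0} (h₂ : (ShortComplex.mk i₂ p₂ w₂).ShortExact)
    {i₃ : A₃ ⟶ B₃} {p₃ : B₃ ⟶ C₃} {w₃ : i₃ ≫ p₃ = 0} (h₃ : (ShortComplex.mk i₃ p₃ w₃).ShortExact)
    (cf : fA ≫ i₂ = i₁ ≫ fB) (cg : gA ≫ i₃ = i₂ ≫ gB)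
    (df : fB ≫ p₂ = p₁ ≫ fC) (dg : gB ≫ p₃ = p₂ ≫ gC) :
    hC.extClass.comp h₁.extClass rfl = -h₃.extClass.comp hA.extClass rfl := by
  have : Epi p₂ := h₂.epi_g
  have : Epi gC := hC.epi_g
  have : Mono i₂ := h₂.mono_f
  have : Mono i₃ := h₃.mono_f
  have := hC.mono_f
  have := h₃.mono_f
  -- the kernel of the diagonal of the lower right square
  obtain ⟨q, hq⟩ : ∃ q, q = p₂ ≫ gC := ⟨_, rfl⟩
  have : Epi q := by rw [hq]; infer_instance
  have hT : (ShortComplex.mk _ _ (kernel.condition q)).ShortExact :=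
    { exact := ShortComplex.exact_of_f_is_kernel _ (kernelIsKernel q)
      mono_f := by dsimp; infer_instance
      epi_g := by dsimp; infer_instance }
  obtain ⟨a, ha⟩ : ∃ a : kernel q ⟶ C₁, a ≫ fC = kernel.ι q ≫ p₂ :=
    ⟨hC.exact.lift (kernel.ι q ≫ p₂) (by
      dsimp; rw [Category.assoc, ← hq, kernel.condition]), hC.exact.lift_f _ _⟩
  obtain ⟨b, hb⟩ : ∃ b : kernel q ⟶ A₃, b ≫ i₃ = kernel.ι q ≫ gB :=
    ⟨h₃.exact.lift (kernel.ι q ≫ gB) (by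
      dsimp; rw [Category.assoc, dg, ← hq, kernel.condition]), h₃.exact.lift_f _ _⟩
  have ea : hT.extClass.comp (Ext.mk₀ a) (add_zero 1) = hC.extClass :=
    (ShortComplex.ShortExact.extClass_naturality hT hC
      { τ₁ := a, τ₂ := p₂, τ₃ := 𝟙 _, comm₁₂ := ha, comm₂₃ := by simp [hq] }).trans
      (Ext.mk₀_id_comp _)
  have eb : hT.extClass.comp (Ext.mk₀ b) (add_zero 1) = h₃.extClass :=
    (ShortComplex.ShortExact.extClass_naturality hT h₃
      { τ₁ := b, τ₂ := gB, τ₃ := 𝟙 _, comm₁₂ := hb, comm₂₃ := by simp [hq, dg] }).trans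
      (Ext.mk₀_id_comp _)
  -- the pullback of the first column maps to both sequences with third terms `C₁` and `A₃`
  have hL := h₁.pullback a
  have ec : hL.extClass = (Ext.mk₀ a).comp h₁.extClass (zero_add 1) :=
    (Ext.comp_mk₀_id _).symm.trans (ShortComplex.ShortExact.extClass_naturality hL h₁
      { τ₁ := 𝟙 _, τ₂ := pullback.snd _ _, τ₃ := a
        comm₁₂ := by dsimp; rw [Category.id_comp, pullback.lift_snd]
        comm₂₃ := pullback.condition.symm })
  have ed : -hL.extClass = (Ext.mk₀ b).comp hA.extClass (zero_add 1) := by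
    obtain ⟨s, hs⟩ : ∃ s : Limits.pullback a p₁ ⟶ A₂,
        s ≫ i₂ = pullback.fst _ _ ≫ kernel.ι q - pullback.snd _ _ ≫ fB :=
      ⟨h₂.exact.lift (pullback.fst _ _ ≫ kernel.ι q - pullback.snd _ _ ≫ fB) (by
        dsimp
        rw [Preadditive.sub_comp, Category.assoc, Category.assoc, ← ha, df,
          pullback.condition_assoc, sub_self]), h₂.exact.lift_f _ _⟩
    -- the difference of the two maps from the pullback to `B₂` restricts to `-𝟙` on `A₁`, whence
    -- the sign
    have := ShortComplex.ShortExact.extClass_naturality hL hA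
      { τ₁ := -𝟙 _, τ₂ := s, τ₃ := b
        comm₁₂ := by
          rw [← cancel_mono i₂]
          dsimp
          rw [Category.assoc, Category.assoc, hs, Preadditive.comp_sub, pullback.lift_fst_assoc,
            pullback.lift_snd_assoc, Preadditive.neg_comp, Category.id_comp, cf, zero_comp,
            zero_sub]
        comm₂₃ := by
          rw [← cancel_mono i₃]
          dsimp
          rw [Category.assoc, Category.assoc, hb, cg, reassoc_of% hs, Preadditive.sub_comp,
            Category.assoc, Category.assoc, wB, comp_zero, sub_zero] }
    refine Eq.trans ?_ this
    dsimp only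
    rw [Ext.mk₀_neg, Ext.comp_neg]
    exact congrArg _ (Ext.comp_mk₀_id _).symm
  rw [← ea, ← eb, Ext.comp_assoc _ _ _ (add_zero 1) (zero_add 1) (by lia),
    Ext.comp_assoc _ _ _ (add_zero 1) (zero_add 1) (by lia)]
  refine (congrArg (fun z => hT.extClass.comp z rfl) ec.symm).trans ?_
  refine Eq.trans ?_ (congrArg (fun z => -hT.extClass.comp z rfl) ed)
  rw [Ext.comp_neg, neg_neg]

variable {F F' F''}

/-- The connecting classes of a short exact sequence `0 → F' → T → F'' → 0` of functors are
natural with respect to extension classes of degree `n`, up to the sign `(-1) ^ n`. -/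
theorem CategoryTheory.Abelian.Ext.mapExactFunctor_comp_extClass [EnoughProjectives C]
    {T : C ⥤ D} [T.Additive] (i : F' ⟶ T) (p : T ⟶ F'') (w : ∀ X, i.app X ≫ p.app X = 0)
    (h : ∀ X, (ShortComplex.mk (i.app X) (p.app X) (w X)).ShortExact)
    {X Y : C} {n : ℕ} (x : Ext.{w₁} X Y n) :
    (x.mapExactFunctor F'' : Ext.{w₂} _ _ n).comp (h Y).extClass rfl =
      (-1 : ℤ) ^ n • (h X).extClass.comp (x.mapExactFunctor F') (add_comm 1 n) := by
  induction x using induction_of_enoughProjectives with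
  | @mk₀ X Y f =>
    have := ShortComplex.ShortExact.extClass_naturality (h X) (h Y)
      { τ₁ := F'.map f, τ₂ := T.map f, τ₃ := F''.map f }
    rw [mapExactFunctor_mk₀, mapExactFunctor_mk₀, pow_zero, one_smul]
    exact this.symm
  | @extClass S hS =>
    rw [mapExactFunctor_extClass, mapExactFunctor_extClass, pow_one, neg_one_zsmul]
    exact ShortComplex.ShortExact.extClass_comp_extClass_eq_neg (hS.map_of_exact F')
      (fB := T.map S.f) (gB := T.map S.g) (by rw [← T.map_comp, S.zero, T.map_zero])
      (hS.map_of_exact F'') (h S.X₁) (h S.X₂) (h S.X₃)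
      (by simp) (by simp) (by simp) (by simp)
  | @comp X Y Z a b c α β hab hα hβ =>
    subst hab
    rw [mapExactFunctor_comp, mapExactFunctor_comp, comp_assoc _ _ _ rfl rfl rfl, hβ, comp_zsmul,
      ← comp_assoc _ _ _ rfl (add_comm 1 b) (by lia), hα, zsmul_comp,
      comp_assoc _ _ _ (add_comm 1 a) rfl (by lia), smul_smul, ← pow_add, add_comm b a]

end ExtNaturality

/-! ### Transfer of Noetherianity between total Ext groups -/

/-- A retraction principle for Noetherian modules over two rings: a submodule `N` of `M` is
recovered from the `S`-submodule generated by `f N`. -/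
theorem isNoetherian_of_retract {R S M M' : Type*} [Ring R] [Ring S] [AddCommGroup M]
    [AddCommGroup M'] [Module R M] [Module S M'] (f : M → M') (p : M' →+ M) (q : S → R)
    (hf : ∀ m, p (f m) = m) (hp : ∀ s m, p (s • f m) = q s • m) [h : IsNoetherian S M'] :
    IsNoetherian R M := by
  have key (N : Submodule R M) : ∀ t ∈ Submodule.span S (f '' N), p t ∈ N := by
    intro t ht
    induction ht using Submodule.span_induction with
    | mem x hx => obtain ⟨m, hm, rfl⟩ := hx; rwa [hf]
    | zero => rw [map_zero]; exact N.zero_mem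
    | add x y _ _ hx hy => rw [map_add]; exact N.add_mem hx hy
    | smul s x hx h' =>
      clear h'
      induction hx using Submodule.span_induction generalizing s with
      | mem x hx => obtain ⟨m, hm, rfl⟩ := hx; rw [hp]; exact N.smul_mem _ hm
      | zero => rw [smul_zero, map_zero]; exact N.zero_mem
      | add x y _ _ hx hy => rw [smul_add, map_add]; exact N.add_mem (hx s) (hy s)
      | smul r x _ hx => rw [smul_smul]; exact hx _
  rw [isNoetherian_iff'] at h ⊢
  refine StrictMono.wellFoundedGT (f := fun N : Submodule R M => Submodule.span S (f '' N)) ?_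
  · intro N N' hlt
    refine lt_of_le_of_ne (Submodule.span_mono (Set.image_mono hlt.le)) fun e => hlt.not_ge ?_
    intro m hm
    have : f m ∈ Submodule.span S (f '' N) := by
      dsimp only at e
      rw [e]; exact Submodule.subset_span ⟨m, hm, rfl⟩
    simpa [hf] using key N _ this

namespace ExtStar

open Limits Abelian

universe w₁ w₂ w₃ v₁ v₂ v₃ u₁ u₂ u₃

variable {C : Type u₁} [Category.{v₁} C] [Abelian C] [HasExt.{w₁} C]
variable {D : Type u₂} [Category.{v₂} D] [Abelian D] [HasExt.{w₂} D]
variable {E : Type u₃} [Category.{v₃} E] [Abelian E] [HasExt.{w₃} E]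

theorem yoneda_of_of' {X Y Z : C} {m n p : ℕ} (h : m + n = p) (θ : Ext.{w₁} Y Z n)
    (η : Ext.{w₁} X Y m) :
    yoneda X Y Z (of Y Z n θ) (of X Y m η) = of X Z p (η.comp θ h) := by
  subst h; exact yoneda_of_of θ η

/-- A morphism, as an element of degree `0` of `Ext^*(X, Y)`. -/
def ofHom {X Y : C} (f : X ⟶ Y) : ExtStar.{w₁} X Y :=
  of X Y 0 (Ext.mk₀ f)

theorem ofHom_comp {X Y Z : C} (f : X ⟶ Y) (g : Y ⟶ Z) :
    ofHom (f ≫ g) = yoneda X Y Z (ofHom g) (ofHom f) := by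
  rw [ofHom, ofHom, ofHom, yoneda_of_of' (add_zero 0), Ext.mk₀_comp_mk₀]

theorem yoneda_ofHom_id {X Y : C} (a : ExtStar.{w₁} X Y) : yoneda X X Y a (ofHom (𝟙 X)) = a :=
  yoneda_id a

theorem ofHom_id_yoneda {X Y : C} (a : ExtStar.{w₁} X Y) : yoneda X Y Y (ofHom (𝟙 Y)) a = a :=
  id_yoneda a

theorem op_smul_eq {X Y : C} (s : (ExtStar.{w₁} X X)ᵐᵒᵖ) (a : ExtStar.{w₁} X Y) :
    s • a = yoneda X X Y a s.unop := rfl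

section Map

variable (F F' : C ⥤ D)
  [F.Additive] [PreservesFiniteLimits F] [PreservesFiniteColimits F]
  [F'.Additive] [PreservesFiniteLimits F'] [PreservesFiniteColimits F']
  (G : D ⥤ E) [G.Additive] [PreservesFiniteLimits G] [PreservesFiniteColimits G]

/-- The map on total Ext groups induced by an exact functor. -/
def map (X Y : C) : ExtStar.{w₁} X Y →+ ExtStar.{w₂} (F.obj X) (F.obj Y) :=
  lift fun n => (of (F.obj X) (F.obj Y) n).comp (F.mapExtAddHom X Y n)

theorem map_of {X Y : C} {n : ℕ} (x : Ext.{w₁} X Y n) :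
    map F X Y (of X Y n x) = of (F.obj X) (F.obj Y) n (x.mapExactFunctor F : Ext.{w₂} _ _ n) :=
  lift_of _ _ _

theorem map_ofHom {X Y : C} (f : X ⟶ Y) :
    map F X Y (ofHom f) = (ofHom (F.map f) : ExtStar.{w₂} _ _) := by
  rw [ofHom, map_of, Ext.mapExactFunctor_mk₀, ofHom]

theorem map_yoneda {X Y Z : C} (b : ExtStar.{w₁} Y Z) (a : ExtStar.{w₁} X Y) :
    map F X Z (yoneda X Y Z b a) =
      yoneda _ _ _ (map F Y Z b : ExtStar.{w₂} _ _) (map F X Y a) := by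
  let L : ExtStar.{w₁} Y Z →+ ExtStar.{w₁} X Y →+ ExtStar.{w₂} (F.obj X) (F.obj Z) :=
    (AddMonoidHom.compHom (map F X Z)).comp (yoneda X Y Z)
  let R : ExtStar.{w₁} Y Z →+ ExtStar.{w₁} X Y →+ ExtStar.{w₂} (F.obj X) (F.obj Z) :=
    ((AddMonoidHom.compHom (M := ExtStar.{w₁} X Y)).flip (map F X Y)).comp
      ((yoneda (F.obj X) (F.obj Y) (F.obj Z)).comp (map F Y Z))
  have h : L = R := by
    refine hom_ext fun n β => hom_ext fun m α => ?_
    change map F X Z (yoneda X Y Z (of Y Z n β) (of X Y m α)) =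
      yoneda _ _ _ (map F Y Z (of Y Z n β)) (map F X Y (of X Y m α))
    rw [yoneda_of_of, map_of, map_of, map_of, yoneda_of_of, Ext.mapExactFunctor_comp]
  exact DFunLike.congr_fun (DFunLike.congr_fun h b) a

variable {F F'} in
theorem map_naturality [EnoughProjectives C] (τ : F ⟶ F') {X Y : C} (x : ExtStar.{w₁} X Y) :
    yoneda _ _ _ (ofHom (τ.app Y)) (map F X Y x : ExtStar.{w₂} _ _) =
      yoneda _ _ _ (map F' X Y x) (ofHom (τ.app X)) := by
  have h : (yoneda _ _ _ (ofHom (τ.app Y))).comp (map F X Y) =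
      ((yoneda _ _ _).flip (ofHom (τ.app X) : ExtStar.{w₂} _ _)).comp (map F' X Y) := by
    refine hom_ext fun n x => ?_
    change yoneda _ _ _ (ofHom (τ.app Y)) (map F X Y (of X Y n x)) =
      yoneda _ _ _ (map F' X Y (of X Y n x)) (ofHom (τ.app X))
    rw [map_of, map_of, ofHom, ofHom, yoneda_of_of' (add_zero n), yoneda_of_of' (zero_add n),
      Ext.mapExactFunctor_naturality]
  exact DFunLike.congr_fun h x

theorem map_id [EnoughProjectives C] {X Y : C} (x : ExtStar.{w₁} X Y) : map (𝟭 C) X Y x = x := by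
  have h : map (𝟭 C) X Y = AddMonoidHom.id _ := hom_ext fun n x => by
    rw [map_of, Ext.mapExactFunctor_id]; rfl
  exact DFunLike.congr_fun h x

theorem map_map [EnoughProjectives C] {X Y : C} (x : ExtStar.{w₁} X Y) :
    map G _ _ (map F X Y x : ExtStar.{w₂} _ _) = (map (F ⋙ G) X Y x : ExtStar.{w₃} _ _) := by
  have h : (map G _ _).comp (map F X Y : _ →+ ExtStar.{w₂} _ _) =
      (map (F ⋙ G) X Y : _ →+ ExtStar.{w₃} _ _) := hom_ext fun n x => by
    change map G _ _ (map F X Y (of X Y n x)) = _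
    rw [map_of, map_of, map_of, Ext.mapExactFunctor_mapExactFunctor]; rfl
  exact DFunLike.congr_fun h x

end Map

/-- `Ext^*(X, Y)` is a Noetherian right module over `Ext^*(X, X)`. -/
def IsNoeth (X Y : C) : Prop :=
  IsNoetherian (ExtStar.{w₁} X X)ᵐᵒᵖ (ExtStar.{w₁} X Y)

theorem IsNoeth.of_iso {X X' Y : C} (e : X ≅ X') (h : IsNoeth.{w₁} X Y) : IsNoeth.{w₁} X' Y := by
  have : IsNoetherian _ _ := h
  refine isNoetherian_of_retract (S := (ExtStar.{w₁} X X)ᵐᵒᵖ) (M' := ExtStar.{w₁} X Y)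
    (yoneda _ _ _ · (ofHom e.hom)) ((yoneda _ _ _).flip (ofHom e.inv))
    (fun s => op (yoneda _ _ _ (ofHom e.hom) (yoneda _ _ _ s.unop (ofHom e.inv)))) ?_ ?_
  · intro m
    rw [AddMonoidHom.flip_apply, yoneda_assoc, ← ofHom_comp, e.inv_hom_id, yoneda_ofHom_id]
  · intro s m
    simp only [AddMonoidHom.flip_apply, op_smul_eq, yoneda_assoc, unop_op]

variable (F : C ⥤ D) [F.Additive] [PreservesFiniteLimits F] [PreservesFiniteColimits F]
  (U : D ⥤ C) [U.Additive] [PreservesFiniteLimits U] [PreservesFiniteColimits U]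

/-- If the identity of `C` is a retract of `F ⋙ U`, Noetherianity descends along `F`. -/
theorem IsNoeth.of_retract [EnoughProjectives C] (i : 𝟭 C ⟶ F ⋙ U) (r : F ⋙ U ⟶ 𝟭 C)
    (hir : i ≫ r = 𝟙 _) {X Y : C}
    (h : IsNoeth.{w₂} (F.obj X) (F.obj Y)) : IsNoeth.{w₁} X Y := by
  have : IsNoetherian _ _ := h
  let p (Y : C) : ExtStar.{w₂} (F.obj X) (F.obj Y) →+ ExtStar.{w₁} X Y :=
    ((yoneda _ _ _).flip (ofHom (i.app X))).comp
      ((yoneda _ _ _ (ofHom (r.app Y))).comp (map U (F.obj X) (F.obj Y)))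
  have hp (Y : C) (t : ExtStar.{w₂} (F.obj X) (F.obj Y)) : p Y t =
      yoneda X (U.obj (F.obj X)) Y
        (yoneda (U.obj (F.obj X)) (U.obj (F.obj Y)) Y (ofHom (r.app Y)) (map U _ _ t))
        (ofHom (i.app X)) := rfl
  have key (Y : C) (m : ExtStar.{w₁} X Y) (s : ExtStar.{w₂} (F.obj X) (F.obj X)) :
      p Y (yoneda _ _ _ (map F X Y m) s) = yoneda _ _ _ m (p X s) := by
    have := map_naturality.{w₁, w₁} r m
    rw [map_id] at this
    rw [hp, hp, map_yoneda, map_map, ← yoneda_assoc, ← yoneda_assoc, ← yoneda_assoc]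
    exact congrArg (fun z => yoneda _ _ _ (yoneda _ _ _ z _) _) this
  have hone : p X (idElem (F.obj X)) = idElem X := by
    have : (ofHom (U.map (𝟙 (F.obj X))) : ExtStar.{w₁} _ _) = ofHom (𝟙 _) := by rw [U.map_id]
    rw [hp]
    change yoneda _ _ _ (yoneda _ _ _ _ (map U _ _ (ofHom (𝟙 _)))) _ = ofHom (𝟙 _)
    rw [map_ofHom, this, yoneda_ofHom_id]
    have := congrArg ofHom.{w₁} (NatTrans.congr_app hir X)
    exact (ofHom_comp _ _).symm.trans this
  refine isNoetherian_of_retract (S := (ExtStar.{w₂} (F.obj X) (F.obj X))ᵐᵒᵖ)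
    (M' := ExtStar.{w₂} (F.obj X) (F.obj Y)) (map F X Y) (p Y) (fun s => op (p X s.unop)) ?_ ?_
  · intro m
    have := key Y m (idElem _)
    rwa [yoneda_id, hone, yoneda_id] at this
  · intro s m
    exact key Y m s.unop

/-- Noetherianity passes from `Ext^*(X, U Y)` to `Ext^*(F X, Y)`, for `F` left adjoint to `U`. -/
theorem IsNoeth.of_adjunction [EnoughProjectives D] (η : 𝟭 C ⟶ F ⋙ U) (ε : U ⋙ F ⟶ 𝟭 D)
    {X : C} (hX : F.map (η.app X) ≫ ε.app (F.obj X) = 𝟙 _) {Y : D}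
    (h : IsNoeth.{w₁} X (U.obj Y)) : IsNoeth.{w₂} (F.obj X) Y := by
  have : IsNoetherian _ _ := h
  have key (m : ExtStar.{w₂} (F.obj X) Y) (s : ExtStar.{w₁} X X) :
      yoneda _ _ _ (ofHom (ε.app Y)) (map F _ _ (yoneda X _ (U.obj Y)
        (yoneda X (U.obj (F.obj X)) _ (map U _ _ m) (ofHom (η.app X))) s)) =
      yoneda _ _ _ m (map F X X s) := by
    have nat : yoneda (F.obj (U.obj (F.obj X))) (F.obj (U.obj Y)) Y (ofHom (ε.app Y))
        (map F _ _ (map U _ _ m : ExtStar.{w₁} _ _)) =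
        yoneda (F.obj (U.obj (F.obj X))) (F.obj X) Y m (ofHom (ε.app (F.obj X))) := by
      have := map_naturality.{w₂, w₂} ε m
      rw [map_id] at this
      rw [map_map]
      exact this
    have tri : yoneda (F.obj X) (F.obj (U.obj (F.obj X))) (F.obj X)
        (ofHom (ε.app (F.obj X))) (ofHom (F.map (η.app X))) =
        (ofHom (𝟙 (F.obj X)) : ExtStar.{w₂} _ _) :=
      (ofHom_comp _ _).symm.trans (congrArg ofHom hX)
    have e : (map F X (U.obj (F.obj X)) (ofHom (η.app X)) : ExtStar.{w₂} _ _) =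
      ofHom (F.map (η.app X)) := map_ofHom F (η.app X)
    rw [map_yoneda, map_yoneda, e, yoneda_assoc]
    refine (yoneda_assoc _ _ _).symm.trans ?_
    refine (congrArg (fun z => yoneda _ _ _ z _) nat).trans ?_
    rw [yoneda_assoc, ← yoneda_assoc _ _ (map F X X s), tri, ofHom_id_yoneda]
  refine isNoetherian_of_retract (S := (ExtStar.{w₁} X X)ᵐᵒᵖ)
    (M' := ExtStar.{w₁} X (U.obj Y))
    (fun m => yoneda X (U.obj (F.obj X)) _ (map U _ _ m) (ofHom (η.app X)))
    ((yoneda _ _ _ (ofHom (ε.app Y))).comp (map F _ _)) (fun s => op (map F X X s.unop)) ?_ ?_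
  · intro m
    have := key m (idElem X)
    rw [yoneda_id] at this
    refine this.trans ?_
    rw [idElem, ← ofHom, map_ofHom, F.map_id, yoneda_ofHom_id]
  · intro s m
    exact key m s.unop

end ExtStar

/-! ### Graded commutativity and opposite rings -/

namespace ExtStar

open Limits Abelian

universe w₁ v₁ u₁

variable {C : Type u₁} [Category.{v₁} C] [Abelian C] [HasExt.{w₁} C]

/-- The additive endomorphism of `Ext^*(X, X)` which is multiplication by `(-1) ^ (n choose 2)` in
degree `n`. If `Ext^*(X, X)` is graded commutative, it reverses products, because
`(m + n choose 2) = (m choose 2) + (n choose 2) + m * n`. -/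
def twist (X : C) : ExtStar.{w₁} X X →+ ExtStar.{w₁} X X :=
  lift fun n => (-1 : ℤ) ^ n.choose 2 • of X X n

theorem twist_of {X : C} {n : ℕ} (x : Ext.{w₁} X X n) :
    twist X (of X X n x) = (-1 : ℤ) ^ n.choose 2 • of X X n x :=
  lift_of _ _ _

theorem twist_twist {X : C} (a : ExtStar.{w₁} X X) : twist X (twist X a) = a := by
  have h : (twist X).comp (twist X) = AddMonoidHom.id (ExtStar.{w₁} X X) :=
    hom_ext fun n x => by
      rw [AddMonoidHom.comp_apply, twist_of, map_zsmul, twist_of, smul_smul, ← pow_add,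
        Even.neg_one_pow ⟨_, rfl⟩, one_smul]
      rfl
  exact DFunLike.congr_fun h a

theorem twist_mul {X : C}
    (hcomm : ∀ (m n : ℕ) (x : Ext.{w₁} X X m) (y : Ext.{w₁} X X n),
      x.comp y rfl = (-1 : ℤ) ^ (m * n) • y.comp x (add_comm n m))
    (a b : ExtStar.{w₁} X X) : twist X (a * b) = twist X b * twist X a := by
  let L : ExtStar.{w₁} X X →+ ExtStar.{w₁} X X →+ ExtStar.{w₁} X X :=
    (AddMonoidHom.compHom (twist X)).comp (yoneda X X X)
  let R : ExtStar.{w₁} X X →+ ExtStar.{w₁} X X →+ ExtStar.{w₁} X X :=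
    ((AddMonoidHom.compHom (M := ExtStar.{w₁} X X)).flip (twist X)).comp
      ((yoneda X X X).flip.comp (twist X))
  have h : L = R := by
    refine hom_ext fun n y => hom_ext fun m x => ?_
    change twist X (yoneda X X X (of X X n y) (of X X m x)) =
      yoneda X X X (twist X (of X X m x)) (twist X (of X X n y))
    rw [yoneda_of_of, twist_of, twist_of, twist_of, map_zsmul, map_zsmul, AddMonoidHom.zsmul_apply,
      yoneda_of_of' (add_comm n m), hcomm, map_zsmul, smul_smul, smul_smul, ← pow_add, ← pow_add]
    congr 1
    have e : (m + n).choose 2 = m.choose 2 + n.choose 2 + m * n := by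
      clear * -
      induction n with
      | zero => simp
      | succ n ih => rw [← add_assoc, Nat.choose_succ_succ' (m + n), Nat.choose_succ_succ' n, ih,
          Nat.choose_one_right, Nat.choose_one_right]; ring
    rw [e, show m.choose 2 + n.choose 2 + m * n + m * n =
      (n.choose 2 + m.choose 2) + (m * n + m * n) by ring, pow_add _ (n.choose 2 + m.choose 2),
      Even.neg_one_pow ⟨_, rfl⟩, mul_one]
  exact DFunLike.congr_fun (DFunLike.congr_fun h a) b

/-- A graded commutative ring `Ext^*(X, X)` is isomorphic to its opposite. -/
def equivOpposite {X : C}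
    (hcomm : ∀ (m n : ℕ) (x : Ext.{w₁} X X m) (y : Ext.{w₁} X X n),
      x.comp y rfl = (-1 : ℤ) ^ (m * n) • y.comp x (add_comm n m)) :
    ExtStar.{w₁} X X ≃+* (ExtStar.{w₁} X X)ᵐᵒᵖ where
  toFun a := op (twist X a)
  invFun a := twist X a.unop
  left_inv := twist_twist
  right_inv a := congrArg op (twist_twist a.unop)
  map_add' a b := congrArg op (map_add _ a b)
  map_mul' a b := congrArg op (twist_mul hcomm a b)

end ExtStar

/-! ### Tensor products of bimodules over a noncommutative algebra -/

section Balanced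

variable (k : Type v) [CommRing k] (A : Type u) [Ring A] [Algebra k A]

/-- Left multiplication by elements of `A`, as elements of the enveloping algebra. -/
def EnvelopingAlgebra.left : A →+* EnvelopingAlgebra k A :=
  (Algebra.TensorProduct.includeLeft : A →ₐ[k] A ⊗[k] Aᵐᵒᵖ).toRingHom

/-- Right multiplication by elements of `A`, as elements of the enveloping algebra. -/
def EnvelopingAlgebra.right : Aᵐᵒᵖ →+* EnvelopingAlgebra k A :=
  (Algebra.TensorProduct.includeRight : Aᵐᵒᵖ →ₐ[k] A ⊗[k] Aᵐᵒᵖ).toRingHom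

namespace EnvelopingAlgebra

theorem left_mul_right (a : A) (b : Aᵐᵒᵖ) : left k A a * right k A b = a ⊗ₜ b := by
  simp [left, right]

theorem right_mul_left (a : A) (b : Aᵐᵒᵖ) : right k A b * left k A a = a ⊗ₜ b := by
  simp [left, right]

theorem left_algebraMap (c : k) : left k A (algebraMap k A c) = algebraMap k _ c := rfl

theorem right_algebraMap (c : k) : right k A (algebraMap k Aᵐᵒᵖ c) = algebraMap k _ c :=
  (Algebra.TensorProduct.includeRight : Aᵐᵒᵖ →ₐ[k] A ⊗[k] Aᵐᵒᵖ).commutes c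

variable {k A} in
theorem smul_right_comm {M : Type*} [AddCommGroup M] [Module (EnvelopingAlgebra k A) M]
    (a : A) (b : Aᵐᵒᵖ) (m : M) :
    left k A a • right k A b • m = right k A b • left k A a • m := by
  rw [smul_smul, smul_smul, left_mul_right, right_mul_left]

variable {k A} in
/-- Additive maps between bimodules commuting with both multiplications are linear. -/
def linearMap {M N : Type*} [AddCommGroup M] [AddCommGroup N] [Module (EnvelopingAlgebra k A) M]
    [Module (EnvelopingAlgebra k A) N] (f : M →+ N)
    (hl : ∀ a m, f (left k A a • m) = left k A a • f m)
    (hr : ∀ a m, f (right k A a • m) = right k A a • f m) : M →ₗ[EnvelopingAlgebra k A] N where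
  __ := f
  map_smul' e m := by
    change f (e • m) = e • f m
    induction e using TensorProduct.induction_on with
    | zero =>
      exact (congrArg f (zero_smul (EnvelopingAlgebra k A) m)).trans
        ((map_zero f).trans (zero_smul (EnvelopingAlgebra k A) (f m)).symm)
    | add x y hx hy => rw [add_smul, add_smul, map_add, hx, hy]
    | tmul a b => rw [← left_mul_right, mul_smul, mul_smul, hl, hr]

end EnvelopingAlgebra

open EnvelopingAlgebra

variable (M W : Type*) [AddCommGroup M] [AddCommGroup W]
  [Module (EnvelopingAlgebra k A) M] [Module (EnvelopingAlgebra k A) W]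

/-- The tensor product `M ⊗_A W` of two bimodules over the noncommutative algebra `A`, as the
quotient of `M ⊗_ℤ W` by the relations `m a ⊗ w = m ⊗ a w`. -/
def BimoduleTensor : Type _ :=
  (M ⊗[ℤ] W) ⧸ AddSubgroup.closure {t : M ⊗[ℤ] W | ∃ (a : A) (m : M) (w : W),
    t = (right k A (op a) • m) ⊗ₜ w - m ⊗ₜ (left k A a • w)}

namespace BimoduleTensor

instance : AddCommGroup (BimoduleTensor k A M W) :=
  inferInstanceAs (AddCommGroup ((M ⊗[ℤ] W) ⧸ AddSubgroup.closure _))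

/-- The class of the pure tensor `m ⊗ w`. -/
def mk : M →+ W →+ BimoduleTensor k A M W :=
  (AddMonoidHom.compHom (QuotientAddGroup.mk' _)).comp
    (LinearMap.toAddMonoidHom'.comp (TensorProduct.mk ℤ M W).toAddMonoidHom)

variable {k A M W}

theorem mk_balanced (a : A) (m : M) (w : W) :
    mk k A M W (right k A (op a) • m) w = mk k A M W m (left k A a • w) := by
  refine (QuotientAddGroup.eq_iff_sub_mem).2 (AddSubgroup.subset_closure ⟨a, m, w, rfl⟩)

theorem hom_ext {N : Type*} [AddCommGroup N] {f g : BimoduleTensor k A M W →+ N}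
    (h : ∀ m w, f (mk k A M W m w) = g (mk k A M W m w)) : f = g := by
  refine QuotientAddGroup.addMonoidHom_ext _ ?_
  ext t
  induction t with
  | zero => simp
  | add x y hx hy => rw [map_add, map_add, hx, hy]
  | tmul m w => exact h m w

@[elab_as_elim]
theorem induction_on {P : BimoduleTensor k A M W → Prop} (t : BimoduleTensor k A M W)
    (mk : ∀ m w, P (mk k A M W m w)) (add : ∀ x y, P x → P y → P (x + y)) : P t := by
  obtain ⟨t, rfl⟩ := QuotientAddGroup.mk_surjective t
  induction t with
  | zero =>
    have := mk 0 0
    rwa [map_zero] at this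
  | add x y hx hy => exact add _ _ hx hy
  | tmul m w => exact mk m w

/-- The additive map out of `M ⊗_A W` induced by a balanced biadditive map. -/
def lift {N : Type*} [AddCommGroup N] (f : M →+ W →+ N)
    (hf : ∀ a m w, f (right k A (op a) • m) w = f m (left k A a • w)) :
    BimoduleTensor k A M W →+ N :=
  QuotientAddGroup.lift _ (TensorProduct.liftAddHom f fun r m w => by
      rw [map_zsmul, map_zsmul, AddMonoidHom.zsmul_apply]) <| by
    rw [AddSubgroup.closure_le]
    rintro _ ⟨a, m, w, rfl⟩
    simp [hf, AddMonoidHom.mem_ker]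

variable {M' W' : Type*} [AddCommGroup M'] [AddCommGroup W']
  [Module (EnvelopingAlgebra k A) M'] [Module (EnvelopingAlgebra k A) W']

/-- The tensor product of a right linear map and a left linear map. -/
def map (f : M →+ M') (g : W →+ W') (hf : ∀ a m, f (right k A a • m) = right k A a • f m)
    (hg : ∀ a w, g (left k A a • w) = left k A a • g w) :
    BimoduleTensor k A M W →+ BimoduleTensor k A M' W' :=
  lift (((mk k A M' W').comp f).flip.comp g).flip fun a m w => by
    change mk k A M' W' (f (right k A (op a) • m)) (g w) =
      mk k A M' W' (f m) (g (left k A a • w))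
    rw [hf, hg, mk_balanced]

instance : Module A (BimoduleTensor k A M W) :=
  Module.compHom (R := AddMonoid.End (BimoduleTensor k A M W)) _
    { toFun a := map (DistribSMul.toAddMonoidHom M (left k A a)) (AddMonoidHom.id W)
        (fun _ _ => smul_right_comm _ _ _) (fun _ _ => rfl)
      map_one' := hom_ext fun m w => by
        change mk k A M W (left k A 1 • m) w = _
        rw [map_one, one_smul]; rfl
      map_mul' a b := hom_ext fun m w => by
        change mk k A M W (left k A (a * b) • m) w = mk k A M W (left k A a • left k A b • m) w
        rw [map_mul, mul_smul]
      map_zero' := hom_ext fun m w => by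
        change mk k A M W (left k A 0 • m) w = 0
        rw [map_zero, show (0 : EnvelopingAlgebra k A) • m = 0 from
          zero_smul (EnvelopingAlgebra k A) m, map_zero]; rfl
      map_add' a b := hom_ext fun m w => by
        change mk k A M W (left k A (a + b) • m) w =
          mk k A M W (left k A a • m) w + mk k A M W (left k A b • m) w
        rw [map_add, add_smul, map_add]; rfl }

instance : Module Aᵐᵒᵖ (BimoduleTensor k A M W) :=
  Module.compHom (R := AddMonoid.End (BimoduleTensor k A M W)) _
    { toFun a := map (AddMonoidHom.id M) (DistribSMul.toAddMonoidHom W (right k A a))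
        (fun _ _ => rfl) (fun _ _ => (smul_right_comm _ _ _).symm)
      map_one' := hom_ext fun m w => by
        change mk k A M W m (right k A 1 • w) = _
        rw [map_one, one_smul]; rfl
      map_mul' a b := hom_ext fun m w => by
        change mk k A M W m (right k A (a * b) • w) = mk k A M W m (right k A a • right k A b • w)
        rw [map_mul, mul_smul]
      map_zero' := hom_ext fun m w => by
        change mk k A M W m (right k A 0 • w) = 0
        rw [map_zero, show (0 : EnvelopingAlgebra k A) • w = 0 from
          zero_smul (EnvelopingAlgebra k A) w, map_zero]
      map_add' a b := hom_ext fun m w => by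
        change mk k A M W m (right k A (a + b) • w) =
          mk k A M W m (right k A a • w) + mk k A M W m (right k A b • w)
        rw [map_add, add_smul, map_add] }

theorem smul_mk (a : A) (m : M) (w : W) :
    a • mk k A M W m w = mk k A M W (left k A a • m) w := rfl

theorem op_smul_mk (a : Aᵐᵒᵖ) (m : M) (w : W) :
    a • mk k A M W m w = mk k A M W m (right k A a • w) := rfl

instance : Module k (BimoduleTensor k A M W) := Module.compHom _ (algebraMap k A)

theorem base_smul_mk (c : k) (m : M) (w : W) :
    c • mk k A M W m w = mk k A M W (algebraMap k (EnvelopingAlgebra k A) c • m) w := by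
  rw [← left_algebraMap]; rfl

instance : SMulCommClass A Aᵐᵒᵖ (BimoduleTensor k A M W) where
  smul_comm a b t := by
    induction t using induction_on with
    | mk m w => rfl
    | add x y hx hy => simp only [smul_add, hx, hy]

instance : IsScalarTower k A (BimoduleTensor k A M W) where
  smul_assoc c a t := by
    rw [Algebra.smul_def, mul_smul]; rfl

instance : IsScalarTower k Aᵐᵒᵖ (BimoduleTensor k A M W) where
  smul_assoc c a t := by
    rw [Algebra.smul_def, mul_smul]
    generalize a • t = t
    induction t using induction_on with
    | mk m w =>
      rw [op_smul_mk, base_smul_mk, right_algebraMap, ← left_algebraMap, ← mk_balanced,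
        left_algebraMap, ← right_algebraMap]
      rfl
    | add x y hx hy => simp only [smul_add, hx, hy]

instance : Module (EnvelopingAlgebra k A) (BimoduleTensor k A M W) :=
  TensorProduct.Algebra.module

theorem tmul_smul_mk (a : A) (b : Aᵐᵒᵖ) (m : M) (w : W) :
    (a ⊗ₜ[k] b : EnvelopingAlgebra k A) • mk k A M W m w =
      mk k A M W (left k A a • m) (right k A b • w) := by
  rw [TensorProduct.Algebra.smul_def, op_smul_mk, smul_mk]

theorem left_smul_mk (a : A) (m : M) (w : W) :
    left k A a • mk k A M W m w = mk k A M W (left k A a • m) w := by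
  change (a ⊗ₜ[k] (1 : Aᵐᵒᵖ) : EnvelopingAlgebra k A) • mk k A M W m w = _
  rw [tmul_smul_mk, map_one, one_smul]

theorem right_smul_mk (a : Aᵐᵒᵖ) (m : M) (w : W) :
    right k A a • mk k A M W m w = mk k A M W m (right k A a • w) := by
  change ((1 : A) ⊗ₜ[k] a : EnvelopingAlgebra k A) • mk k A M W m w = _
  rw [tmul_smul_mk, map_one, one_smul]

end BimoduleTensor

end Balanced

/-! ### Exactness of the tensor product with a left projective bimodule -/

section TensorFunctor

open EnvelopingAlgebra BimoduleTensor Limits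

variable {k : Type v} [CommRing k] {A : Type u} [Ring A] [Algebra k A]

/-- The bimodule map `M ⊗_A W → M' ⊗_A W'` induced by two bimodule maps. -/
def BimoduleTensor.mapₗ {M M' W W' : Type*} [AddCommGroup M] [AddCommGroup W]
    [Module (EnvelopingAlgebra k A) M] [Module (EnvelopingAlgebra k A) W]
    [AddCommGroup M'] [AddCommGroup W']
    [Module (EnvelopingAlgebra k A) M'] [Module (EnvelopingAlgebra k A) W']
    (f : M →ₗ[EnvelopingAlgebra k A] M') (g : W →ₗ[EnvelopingAlgebra k A] W') :
    BimoduleTensor k A M W →ₗ[EnvelopingAlgebra k A] BimoduleTensor k A M' W' :=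
  linearMap (BimoduleTensor.map f.toAddMonoidHom g.toAddMonoidHom
    (fun _ _ => f.map_smul _ _) (fun _ _ => g.map_smul _ _))
    (fun a t => by
      induction t using induction_on with
      | mk m w =>
        rw [left_smul_mk]
        exact (congrArg (fun z => mk k A M' W' z (g w)) (f.map_smul (left k A a) m)).trans
          (left_smul_mk _ _ _).symm
      | add x y hx hy => rw [smul_add, map_add, hx, hy, map_add, smul_add])
    (fun a t => by
      induction t using induction_on with
      | mk m w =>
        rw [right_smul_mk]
        exact (congrArg (fun z => mk k A M' W' (f m) z) (g.map_smul (right k A a) w)).trans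
          (right_smul_mk _ _ _).symm
      | add x y hx hy => rw [smul_add, map_add, hx, hy, map_add, smul_add])

theorem BimoduleTensor.linearMap_ext {M W N : Type*} [AddCommGroup M] [AddCommGroup W]
    [Module (EnvelopingAlgebra k A) M] [Module (EnvelopingAlgebra k A) W]
    [AddCommGroup N] [Module (EnvelopingAlgebra k A) N]
    {f g : BimoduleTensor k A M W →ₗ[EnvelopingAlgebra k A] N}
    (h : ∀ m w, f (mk k A M W m w) = g (mk k A M W m w)) : f = g :=
  LinearMap.toAddMonoidHom_injective (hom_ext h)

/-- The endofunctor `M ↦ M ⊗_A W` of the category of bimodules. -/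
def tensorRight (W : ModuleCat.{u} (EnvelopingAlgebra k A)) :
    ModuleCat.{u} (EnvelopingAlgebra k A) ⥤ ModuleCat.{u} (EnvelopingAlgebra k A) where
  obj M := ModuleCat.of _ (BimoduleTensor k A M W)
  map f := ModuleCat.ofHom (mapₗ f.hom LinearMap.id)
  map_id _ := ModuleCat.hom_ext (BimoduleTensor.linearMap_ext fun _ _ => rfl)
  map_comp _ _ := ModuleCat.hom_ext (BimoduleTensor.linearMap_ext fun _ _ => rfl)

instance (W : ModuleCat.{u} (EnvelopingAlgebra k A)) : (tensorRight W).Additive where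
  map_add {M N f g} := ModuleCat.hom_ext (BimoduleTensor.linearMap_ext fun m w => by
    change mk k A N W (f.hom m + g.hom m) w = mk k A N W (f.hom m) w + mk k A N W (g.hom m) w
    rw [map_add]; rfl)

/-- The natural transformation `- ⊗_A W → - ⊗_A W'` induced by a bimodule map `W → W'`. -/
def tensorRightMap {W W' : ModuleCat.{u} (EnvelopingAlgebra k A)} (g : W ⟶ W') :
    tensorRight W ⟶ tensorRight W' where
  app _ := ModuleCat.ofHom (mapₗ LinearMap.id g.hom)
  naturality _ _ _ := ModuleCat.hom_ext (BimoduleTensor.linearMap_ext fun _ _ => rfl)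

/-- A bimodule which is projective as a left module. -/
class LeftProjective (W : ModuleCat.{u} (EnvelopingAlgebra k A)) : Prop where
  projective : letI := Module.compHom W (left k A); Module.Projective A W

/-- A coordinate system for a left projective bimodule. -/
theorem LeftProjective.exists_section (W : ModuleCat.{u} (EnvelopingAlgebra k A))
    [h : LeftProjective W] : ∃ s : W →+ (W →₀ A), (∀ a w, s (left k A a • w) = a • s w) ∧
      ∀ w, (s w).sum (fun v a => left k A a • v) = w := by
  let : Module A W := Module.compHom W (left k A)
  have := h.projective
  obtain ⟨s, hs⟩ := Module.projective_def.1 this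
  exact ⟨s.toAddMonoidHom, fun a w => s.map_smul a w, fun w => hs w⟩

/-- The coordinates of a tensor in `M ⊗_A W` with respect to a coordinate system on `W`. -/
def BimoduleTensor.coords {M W : Type*} [AddCommGroup M] [AddCommGroup W]
    [Module (EnvelopingAlgebra k A) M] [Module (EnvelopingAlgebra k A) W] (s : W →+ (W →₀ A))
    (hs : ∀ a w, s (left k A a • w) = a • s w) : BimoduleTensor k A M W →+ (W →₀ M) :=
  BimoduleTensor.lift
    (AddMonoidHom.mk' (fun m => (Finsupp.mapRange.addMonoidHom
      (AddMonoidHom.mk' (fun a => right k A (op a) • m) fun a b => by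
        rw [MulOpposite.op_add, map_add, add_smul])).comp s)
      fun m n => by
        ext w v
        change right k A (op (s w v)) • (m + n) = right k A _ • m + right k A _ • n
        rw [smul_add])
    fun a m w => by
      ext v
      change right k A (op (s w v)) • right k A (op a) • m =
        right k A (op (s (left k A a • w) v)) • m
      rw [hs, smul_smul, ← map_mul]
      rfl

theorem BimoduleTensor.coords_mk {M W : Type*} [AddCommGroup M] [AddCommGroup W]
    [Module (EnvelopingAlgebra k A) M] [Module (EnvelopingAlgebra k A) W] (s : W →+ (W →₀ A))
    (hs : ∀ a w, s (left k A a • w) = a • s w) (m : M) (w v : W) :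
    coords s hs (mk k A M W m w) v = right k A (op (s w v)) • m := rfl

theorem BimoduleTensor.sum_coords {M W : Type*} [AddCommGroup M] [AddCommGroup W]
    [Module (EnvelopingAlgebra k A) M] [Module (EnvelopingAlgebra k A) W] (s : W →+ (W →₀ A))
    (hs : ∀ a w, s (left k A a • w) = a • s w)
    (hs' : ∀ w, (s w).sum (fun v a => left k A a • v) = w) (t : BimoduleTensor k A M W) :
    (coords s hs t).sum (fun v m => mk k A M W m v) = t := by
  induction t using induction_on with
  | mk m w =>
    conv_rhs => rw [← hs' w]
    rw [Finsupp.sum_of_support_subset _ (s := (s w).support), Finsupp.sum, map_sum]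
    · exact Finset.sum_congr rfl fun v _ => by rw [coords_mk, mk_balanced]
    · intro v hv
      rw [Finsupp.mem_support_iff] at hv ⊢
      intro h
      apply hv
      rw [coords_mk, h, MulOpposite.op_zero, map_zero]
      exact zero_smul (EnvelopingAlgebra k A) m
    · intro v _
      rw [map_zero]; rfl
  | add x y hx hy =>
    rw [map_add, Finsupp.sum_add_index', hx, hy]
    · intro v; rw [map_zero]; rfl
    · intro v m n; rw [map_add]; rfl

theorem BimoduleTensor.coords_mapₗ {M M' W : Type*} [AddCommGroup M] [AddCommGroup W]
    [Module (EnvelopingAlgebra k A) M] [Module (EnvelopingAlgebra k A) W]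
    [AddCommGroup M'] [Module (EnvelopingAlgebra k A) M'] (s : W →+ (W →₀ A))
    (hs : ∀ a w, s (left k A a • w) = a • s w) (f : M →ₗ[EnvelopingAlgebra k A] M')
    (t : BimoduleTensor k A M W) (v : W) :
    coords s hs (mapₗ f LinearMap.id t) v = f (coords s hs t v) := by
  induction t using induction_on with
  | mk m w => exact (f.map_smul _ _).symm
  | add x y hx hy => rw [map_add, map_add, map_add, Finsupp.add_apply, Finsupp.add_apply, hx, hy,
      map_add]

/-- Tensoring with a left projective bimodule is exact, because tensors have coordinates with
respect to a coordinate system of `W`. -/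
theorem tensorRight_map_shortExact (W : ModuleCat.{u} (EnvelopingAlgebra k A)) [LeftProjective W]
    (S : ShortComplex (ModuleCat.{u} (EnvelopingAlgebra k A))) (hS : S.ShortExact) :
    (S.map (tensorRight W)).ShortExact := by
  obtain ⟨s, hs, hs'⟩ := LeftProjective.exists_section W
  have hf := hS.moduleCat_injective_f
  have hg := hS.moduleCat_surjective_g
  have he := (ShortComplex.ShortExact.moduleCat_exact_iff_function_exact S).1 hS.exact
  have hz (M : ModuleCat.{u} (EnvelopingAlgebra k A)) (v : W) :
      mk k A M W 0 v = 0 := by rw [map_zero]; rfl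
  refine ModuleCat.shortComplex_shortExact _ ?_ ?_ ?_
  · intro t
    refine ⟨fun ht => ?_, ?_⟩
    · have ht' : mapₗ S.g.hom LinearMap.id t = (0 : BimoduleTensor k A S.X₃ W) := ht
      have h0 (v : W) : S.g (coords s hs t v) = 0 := by
        refine (coords_mapₗ s hs S.g.hom t v).symm.trans ?_
        rw [ht', map_zero]; rfl
      choose c hc using fun v => (he _).1 (h0 v)
      refine ⟨((coords s hs t).support.sum fun v => mk k A S.X₁ W (c v) v :
        BimoduleTensor k A S.X₁ W), ?_⟩
      refine (map_sum (mapₗ S.f.hom (LinearMap.id : W →ₗ[EnvelopingAlgebra k A] W)) _ _).trans ?_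
      refine Eq.trans (Finset.sum_congr rfl fun v _ => ?_) (sum_coords s hs hs' t)
      exact congrArg (fun z => mk k A S.X₂ W z v) (hc v)
    · rintro ⟨t, rfl⟩
      have := ((S.map (tensorRight W)).zero)
      exact congrArg (fun f => f.hom t) this
  · rw [injective_iff_map_eq_zero]
    intro t ht
    have ht' : mapₗ S.f.hom LinearMap.id t = (0 : BimoduleTensor k A S.X₂ W) := ht
    rw [← sum_coords s hs hs' (t : BimoduleTensor k A S.X₁ W)]
    refine Finset.sum_eq_zero fun v _ => ?_
    have : coords s hs (t : BimoduleTensor k A S.X₁ W) v = 0 := hf (by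
      rw [map_zero]
      refine (coords_mapₗ s hs S.f.hom t v).symm.trans ?_
      rw [ht', map_zero]; rfl)
    exact (congrArg (fun z => mk k A S.X₁ W z v) this).trans (hz S.X₁ v)
  · intro t
    induction (t : BimoduleTensor k A S.X₃ W) using induction_on with
    | mk m w =>
      obtain ⟨n, rfl⟩ := hg m
      exact ⟨mk k A S.X₂ W n w, rfl⟩
    | add x y hx hy =>
      obtain ⟨a, rfl⟩ := hx
      obtain ⟨b, rfl⟩ := hy
      exact ⟨a + b, map_add _ _ _⟩

theorem tensorRight_exact (W : ModuleCat.{u} (EnvelopingAlgebra k A)) [LeftProjective W] :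
    PreservesFiniteLimits (tensorRight W) ∧ PreservesFiniteColimits (tensorRight W) :=
  ((tensorRight W).exact_tfae.out 0 3).1 (tensorRight_map_shortExact W)

instance (W : ModuleCat.{u} (EnvelopingAlgebra k A)) [LeftProjective W] :
    PreservesFiniteLimits (tensorRight W) := (tensorRight_exact W).1

instance (W : ModuleCat.{u} (EnvelopingAlgebra k A)) [LeftProjective W] :
    PreservesFiniteColimits (tensorRight W) := (tensorRight_exact W).2

/-- A short exact sequence of bimodules with left projective third term splits on the left. -/
theorem LeftProjective.exists_splitting
    (S : ShortComplex (ModuleCat.{u} (EnvelopingAlgebra k A)))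
    (hS : S.ShortExact) [h : LeftProjective S.X₃] :
    ∃ (σ : S.X₃ →+ S.X₂) (ρ : S.X₂ →+ S.X₁),
      (∀ a x, σ (left k A a • x) = left k A a • σ x) ∧
      (∀ a x, ρ (left k A a • x) = left k A a • ρ x) ∧
      (∀ x, S.g (σ x) = x) ∧ (∀ x, ρ (S.f x) = x) ∧ ∀ x, S.f (ρ x) + σ (S.g x) = x := by
  have hf := hS.moduleCat_injective_f
  have hg := hS.moduleCat_surjective_g
  have he := (ShortComplex.ShortExact.moduleCat_exact_iff_function_exact S).1 hS.exact
  let : Module A S.X₂ := Module.compHom _ (left k A)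
  let : Module A S.X₃ := Module.compHom _ (left k A)
  have : Module.Projective A S.X₃ := h.projective
  let g : S.X₂ →ₗ[A] S.X₃ :=
    { S.g.hom.toAddMonoidHom with map_smul' := fun a x => S.g.hom.map_smul (left k A a) x }
  obtain ⟨σ, hσ⟩ := Module.projective_lifting_property g LinearMap.id hg
  have hσ' (x : S.X₃) : S.g (σ x) = x := LinearMap.congr_fun hσ x
  have hσl (a : A) (x : S.X₃) : σ (left k A a • x) = left k A a • σ x := σ.map_smul a x
  have hex (x : S.X₂) : ∃ y, S.f y = x - σ (S.g x) := (he _).1 (by rw [map_sub, hσ', sub_self])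
  choose ρ hρ using hex
  refine ⟨σ.toAddMonoidHom, AddMonoidHom.mk' ρ fun x y => hf ?_, hσl, fun a x => hf ?_, hσ',
    fun x => hf ?_, fun x => ?_⟩
  · rw [hρ, map_add, map_add, map_add, hρ, hρ]; abel
  · change S.f (ρ _) = S.f (_ • ρ x)
    rw [hρ, map_smul, hσl, map_smul, hρ, smul_sub]
  · change S.f (ρ _) = _
    rw [hρ, (he _).2 ⟨x, rfl⟩, map_zero, sub_zero]
  · change S.f (ρ _) + σ _ = _
    rw [hρ, sub_add_cancel]

/-- A short exact sequence of bimodules with left projective third term remains exact after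
tensoring on the left with any bimodule. -/
theorem tensorRightMap_shortExact (S : ShortComplex (ModuleCat.{u} (EnvelopingAlgebra k A)))
    (hS : S.ShortExact) [LeftProjective S.X₃] (M : ModuleCat.{u} (EnvelopingAlgebra k A))
    (w : (tensorRightMap S.f).app M ≫ (tensorRightMap S.g).app M = 0) :
    (ShortComplex.mk ((tensorRightMap S.f).app M) ((tensorRightMap S.g).app M) w).ShortExact := by
  obtain ⟨σ, ρ, hσ, hρ, h₃, h₁, h₂⟩ := LeftProjective.exists_splitting S hS
  let σ' : BimoduleTensor k A M S.X₃ →+ BimoduleTensor k A M S.X₂ :=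
    BimoduleTensor.map (AddMonoidHom.id M) σ (fun _ _ => rfl) hσ
  let ρ' : BimoduleTensor k A M S.X₂ →+ BimoduleTensor k A M S.X₁ :=
    BimoduleTensor.map (AddMonoidHom.id M) ρ (fun _ _ => rfl) hρ
  have h₃' (t : BimoduleTensor k A M S.X₃) : mapₗ LinearMap.id S.g.hom (σ' t) = t := by
    induction t using induction_on with
    | mk m w => exact congrArg (fun z => mk k A M S.X₃ m z) (h₃ w)
    | add x y hx hy => rw [map_add, map_add, hx, hy]
  have h₁' (t : BimoduleTensor k A M S.X₁) : ρ' (mapₗ LinearMap.id S.f.hom t) = t := by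
    induction t using induction_on with
    | mk m w => exact congrArg (fun z => mk k A M S.X₁ m z) (h₁ w)
    | add x y hx hy => rw [map_add, map_add, hx, hy]
  have h₂' (t : BimoduleTensor k A M S.X₂) : mapₗ LinearMap.id S.f.hom (ρ' t) +
      σ' (mapₗ LinearMap.id S.g.hom t) = t := by
    induction t using induction_on with
    | mk m w =>
      exact (map_add (mk k A M S.X₂ m) _ _).symm.trans
        (congrArg (fun z => mk k A M S.X₂ m z) (h₂ w))
    | add x y hx hy =>
      conv_rhs => rw [← hx, ← hy]
      rw [map_add, map_add, map_add, map_add]; abel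
  refine ModuleCat.shortComplex_shortExact _ ?_ ?_ ?_
  · intro t
    refine ⟨fun ht => ⟨ρ' t, ?_⟩, ?_⟩
    · have ht' : mapₗ LinearMap.id S.g.hom t = (0 : BimoduleTensor k A M S.X₃) := ht
      have := h₂' t
      rw [ht', map_zero, add_zero] at this
      exact this
    · rintro ⟨t, rfl⟩
      exact congrArg (fun f => f.hom t) w
  · exact Function.LeftInverse.injective h₁'
  · exact Function.RightInverse.surjective h₃'

theorem LeftProjective.of_shortExact (S : ShortComplex (ModuleCat.{u} (EnvelopingAlgebra k A)))
    (hS : S.ShortExact) [LeftProjective S.X₃] [h : LeftProjective S.X₂] : LeftProjective S.X₁ := by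
  obtain ⟨σ, ρ, hσ, hρ, h₃, h₁, h₂⟩ := LeftProjective.exists_splitting S hS
  let : Module A S.X₁ := Module.compHom _ (left k A)
  let : Module A S.X₂ := Module.compHom _ (left k A)
  have : Module.Projective A S.X₂ := h.projective
  let f : S.X₁ →ₗ[A] S.X₂ :=
    { S.f.hom.toAddMonoidHom with map_smul' := fun a x => S.f.hom.map_smul (left k A a) x }
  let r : S.X₂ →ₗ[A] S.X₁ := { ρ with map_smul' := hρ }
  exact ⟨Module.Projective.of_split f r (LinearMap.ext h₁)⟩

theorem Module.Projective.finsupp {R ι M : Type*} [Semiring R] [AddCommMonoid M] [Module R M]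
    [Module.Projective R M] : Module.Projective R (ι →₀ M) := by
  classical
  exact .of_equiv' (finsuppLequivDFinsupp (M := M) R).symm

/-- If `A` is projective over `k`, then projective bimodules are left projective. -/
theorem LeftProjective.of_projective [Module.Projective k A]
    (Q : ModuleCat.{u} (EnvelopingAlgebra k A)) [Module.Projective (EnvelopingAlgebra k A) Q] :
    LeftProjective Q := by
  obtain ⟨s, hs⟩ := Module.projective_def.1
    (inferInstance : Module.Projective (EnvelopingAlgebra k A) Q)
  have : Module.Projective k Aᵐᵒᵖ := .of_equiv' (MulOpposite.opLinearEquiv k)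
  have : Module.Projective A (EnvelopingAlgebra k A) :=
    inferInstanceAs (Module.Projective A (A ⊗[k] Aᵐᵒᵖ))
  have : Module.Projective A (Q →₀ EnvelopingAlgebra k A) := .finsupp
  have hsmul (a : A) (e : EnvelopingAlgebra k A) : a • e = left k A a * e := by
    induction e using TensorProduct.induction_on with
    | zero => exact (smul_zero a).trans (mul_zero (left k A a)).symm
    | add x y hx hy => rw [smul_add, mul_add, hx, hy]
    | tmul x y => simp [left, TensorProduct.smul_tmul']
  have hsmul' (a : A) (e : Q →₀ EnvelopingAlgebra k A) : a • e = left k A a • e :=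
    Finsupp.ext fun x => hsmul a (e x)
  let : Module A Q := Module.compHom _ (left k A)
  let i : Q →ₗ[A] (Q →₀ EnvelopingAlgebra k A) :=
    { s.toAddMonoidHom with
      map_smul' := fun a x => (s.map_smul (left k A a) x).trans (hsmul' a (s x)).symm }
  let r : (Q →₀ EnvelopingAlgebra k A) →ₗ[A] Q :=
    { (Finsupp.linearCombination (EnvelopingAlgebra k A) (id : Q → Q)).toAddMonoidHom with
      map_smul' := fun a x => (congrArg _ (hsmul' a x)).trans
        ((Finsupp.linearCombination (EnvelopingAlgebra k A) (id : Q → Q)).map_smul _ _) }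
  exact ⟨Module.Projective.of_split i r (LinearMap.ext hs)⟩

end TensorFunctor

/-! ### Graded commutativity of Hochschild cohomology -/

section GradedCommutativity

open EnvelopingAlgebra BimoduleTensor Limits Abelian

variable {k : Type v} [CommRing k] {A : Type u} [Ring A] [Algebra k A]

variable (k A) in
/-- The underlying additive group of the regular bimodule. -/
def regularEquiv : A ≃+ regularBimodule k A := AddEquiv.refl A

theorem regular_tmul_smul (a x : A) (b : Aᵐᵒᵖ) :
    (a ⊗ₜ b : EnvelopingAlgebra k A) • regularEquiv k A x = regularEquiv k A (a * (x * b.unop)) :=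
  rfl

theorem regular_left_smul (a x : A) :
    left k A a • regularEquiv k A x = regularEquiv k A (a * x) := by
  refine (regular_tmul_smul a x 1).trans ?_
  rw [unop_one, mul_one]

theorem regular_right_smul (x : A) (b : Aᵐᵒᵖ) :
    right k A b • regularEquiv k A x = regularEquiv k A (x * b.unop) := by
  refine (regular_tmul_smul 1 x b).trans ?_
  rw [one_mul]

theorem regular_symm_left_smul (a : A) (x : regularBimodule k A) :
    (regularEquiv k A).symm (left k A a • x) = a * (regularEquiv k A).symm x := by
  obtain ⟨x, rfl⟩ := (regularEquiv k A).surjective x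
  rw [regular_left_smul, AddEquiv.symm_apply_apply, AddEquiv.symm_apply_apply]

theorem regular_symm_right_smul (b : Aᵐᵒᵖ) (x : regularBimodule k A) :
    (regularEquiv k A).symm (right k A b • x) = (regularEquiv k A).symm x * b.unop := by
  obtain ⟨x, rfl⟩ := (regularEquiv k A).surjective x
  rw [regular_right_smul, AddEquiv.symm_apply_apply, AddEquiv.symm_apply_apply]

/-- The additive map `A ⊗_A W → W`, `a ⊗ w ↦ a w`. -/
def tensorRegularHom (W : Type*) [AddCommGroup W] [Module (EnvelopingAlgebra k A) W] :
    BimoduleTensor k A (regularBimodule k A) W →+ W :=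
  BimoduleTensor.lift
    ((AddMonoidHom.mk' (fun a : A => DistribSMul.toAddMonoidHom W (left k A a)) fun a b => by
      ext w
      exact (congrArg (· • w) (map_add (left k A) a b)).trans (add_smul _ _ _)).comp
        (regularEquiv k A).symm.toAddMonoidHom)
    fun a x w => by
      change left k A ((regularEquiv k A).symm (right k A (op a) • x)) • w =
        left k A ((regularEquiv k A).symm x) • left k A a • w
      rw [regular_symm_right_smul, smul_smul, ← map_mul, unop_op]

theorem tensorRegularHom_mk (W : Type*) [AddCommGroup W] [Module (EnvelopingAlgebra k A) W]
    (a : regularBimodule k A) (w : W) :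
    tensorRegularHom W (mk k A (regularBimodule k A) W a w) =
      left k A ((regularEquiv k A).symm a) • w := rfl

/-- The canonical isomorphism `A ⊗_A W ≅ W`. -/
def tensorRegularIso (W : ModuleCat.{u} (EnvelopingAlgebra k A)) :
    (tensorRight W).obj (regularBimodule k A) ≅ W :=
  LinearEquiv.toModuleIso (X₁ := BimoduleTensor k A (regularBimodule k A) W)
    { linearMap (tensorRegularHom (k := k) (A := A) W)
        (fun a t => by
          induction t using induction_on with
          | mk x w =>
            rw [left_smul_mk, tensorRegularHom_mk, tensorRegularHom_mk, regular_symm_left_smul,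
              map_mul, mul_smul]
          | add x y hx hy => rw [smul_add, map_add, hx, hy, map_add, smul_add])
        (fun a t => by
          induction t using induction_on with
          | mk x w =>
            rw [right_smul_mk, tensorRegularHom_mk, tensorRegularHom_mk, smul_right_comm]
          | add x y hx hy => rw [smul_add, map_add, hx, hy, map_add, smul_add]) with
      invFun := mk k A (regularBimodule k A) W (regularEquiv k A 1)
      left_inv := fun t => by
        change mk k A (regularBimodule k A) W (regularEquiv k A 1) (tensorRegularHom W t) = t
        induction t using induction_on with
        | mk x w =>
          rw [tensorRegularHom_mk, ← mk_balanced, regular_right_smul, one_mul, unop_op,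
            AddEquiv.apply_symm_apply]
        | add x y hx hy => rw [map_add, map_add, hx, hy]
      right_inv := fun w => by
        change tensorRegularHom W (mk k A (regularBimodule k A) W (regularEquiv k A 1) w) = w
        rw [tensorRegularHom_mk, AddEquiv.symm_apply_apply, map_one, one_smul] }

theorem tensorRegularIso_naturality {W W' : ModuleCat.{u} (EnvelopingAlgebra k A)} (g : W ⟶ W') :
    (tensorRightMap g).app (regularBimodule k A) ≫ (tensorRegularIso W').hom =
      (tensorRegularIso W).hom ≫ g :=
  ModuleCat.hom_ext (BimoduleTensor.linearMap_ext fun a w =>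
    (g.hom.map_smul (left k A ((regularEquiv k A).symm a)) w).symm)

/-- The additive map `M ⊗_A W → M`, `m ⊗ w ↦ m (f w)`, induced by a bimodule map `f : W → A`. -/
def tensorContractHom (M : Type*) {W : Type*} [AddCommGroup M] [AddCommGroup W]
    [Module (EnvelopingAlgebra k A) M] [Module (EnvelopingAlgebra k A) W]
    (f : W →ₗ[EnvelopingAlgebra k A] regularBimodule k A) : BimoduleTensor k A M W →+ M :=
  BimoduleTensor.lift
    (AddMonoidHom.mk' (fun m => (AddMonoidHom.mk' (fun a : A => right k A (op a) • m)
        fun a b => (congrArg (· • m) (map_add (right k A) (op a) (op b))).trans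
          (add_smul _ _ _)).comp
          ((regularEquiv k A).symm.toAddMonoidHom.comp f.toAddMonoidHom))
      fun m m' => by ext w; exact smul_add _ _ _)
    fun a m w => by
      change right k A (op ((regularEquiv k A).symm (f w))) • right k A (op a) • m =
        right k A (op ((regularEquiv k A).symm (f (left k A a • w)))) • m
      rw [map_smul, regular_symm_left_smul, op_mul, map_mul, mul_smul]

theorem tensorContractHom_mk {M W : Type*} [AddCommGroup M] [AddCommGroup W]
    [Module (EnvelopingAlgebra k A) M] [Module (EnvelopingAlgebra k A) W]
    (f : W →ₗ[EnvelopingAlgebra k A] regularBimodule k A) (m : M) (w : W) :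
    tensorContractHom M f (mk k A M W m w) =
      right k A (op ((regularEquiv k A).symm (f w))) • m := rfl

/-- The natural transformation `M ⊗_A W → M`, `m ⊗ w ↦ m (f w)`, induced by a bimodule map
`f : W → A`. -/
def tensorContract {W : ModuleCat.{u} (EnvelopingAlgebra k A)} (f : W ⟶ regularBimodule k A) :
    tensorRight W ⟶ 𝟭 (ModuleCat.{u} (EnvelopingAlgebra k A)) where
  app M := ModuleCat.ofHom (X := BimoduleTensor k A M W) (linearMap (tensorContractHom M f.hom)
    (fun a t => by
      induction t using induction_on with
      | mk m w =>
        rw [left_smul_mk, tensorContractHom_mk, tensorContractHom_mk, smul_right_comm]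
      | add x y hx hy => rw [smul_add, map_add, hx, hy, map_add, smul_add])
    (fun a t => by
      induction t using induction_on with
      | mk m w =>
        rw [right_smul_mk, tensorContractHom_mk, tensorContractHom_mk, map_smul,
          regular_symm_right_smul, op_mul, op_unop, map_mul, mul_smul]
      | add x y hx hy => rw [smul_add, map_add, hx, hy, map_add, smul_add]))
  naturality _ _ g := ModuleCat.hom_ext (BimoduleTensor.linearMap_ext fun m w =>
    (g.hom.map_smul _ m).symm)

/-- On the regular bimodule, the contraction `A ⊗_A W → A` is the given map `f : W → A`, up to the
canonical isomorphism `A ⊗_A W ≅ W`. -/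
theorem tensorContract_app {W : ModuleCat.{u} (EnvelopingAlgebra k A)}
    (f : W ⟶ regularBimodule k A) :
    (tensorContract f).app (regularBimodule k A) = (tensorRegularIso W).hom ≫ f :=
  ModuleCat.hom_ext (BimoduleTensor.linearMap_ext fun x w => by
    change right k A (op ((regularEquiv k A).symm (f.hom w))) • x =
      f.hom (left k A ((regularEquiv k A).symm x) • w)
    apply (regularEquiv k A).symm.injective
    rw [regular_symm_right_smul, map_smul, regular_symm_left_smul, unop_op])

instance : LeftProjective (regularBimodule k A) where
  projective := by
    let : Module A (regularBimodule k A) := Module.compHom _ (left k A)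
    exact .of_equiv' (M := A)
      { regularEquiv k A with map_smul' := fun a x => (regular_left_smul a x).symm }

/-- The action of `x` on `Ext^*(W, A)` through the functor `- ⊗_A W` agrees up to sign with the
Yoneda product with `x`. This is proved by dimension shifting in the variable `W`. -/
theorem tensorRight_comp_eq [Module.Projective k A] {m n : ℕ}
    (x : Ext.{u} (regularBimodule k A) (regularBimodule k A) m)
    (W : ModuleCat.{u} (EnvelopingAlgebra k A)) [LeftProjective W]
    (y : Ext.{u} W (regularBimodule k A) n) :
    (x.mapExactFunctor (tensorRight W) : Ext.{u} _ _ m).comp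
      ((Ext.mk₀ (tensorRegularIso W).hom).comp y (zero_add n)) rfl =
    (-1 : ℤ) ^ (m * n) • ((Ext.mk₀ (tensorRegularIso W).hom).comp y (zero_add n)).comp x
      (add_comm n m) := by
  induction n generalizing W with
  | zero =>
    obtain ⟨f, rfl⟩ := (Ext.mk₀_bijective _ _).2 y
    have := Ext.mapExactFunctor_naturality.{u, u} (tensorContract f) x
    rw [Ext.mapExactFunctor_id, tensorContract_app] at this
    rw [Ext.mk₀_comp_mk₀, mul_zero, pow_zero, one_smul]
    exact this
  | succ n ih =>
    -- `y` is the product of the class of `0 → S.X₁ → S.X₂ → W → 0`, with `S.X₂` projective, and a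
    -- class `z` of lower degree
    let S := ShortComplex.mk _ _ (kernel.condition (Projective.π W))
    have hS : S.ShortExact :=
      { exact := ShortComplex.exact_of_f_is_kernel _ (kernelIsKernel S.g) }
    have hP : Projective S.X₂ := by dsimp [S]; infer_instance
    have : Module.Projective (EnvelopingAlgebra k A) S.X₂ :=
      (IsProjective.iff_projective (R := EnvelopingAlgebra k A) S.X₂).2 hP
    have : LeftProjective S.X₃ := ‹LeftProjective W›
    have : LeftProjective S.X₂ := .of_projective _
    have : LeftProjective S.X₁ := .of_shortExact S hS
    obtain ⟨z, rfl⟩ := Ext.contravariant_sequence_exact₃ hS _ y (Ext.eq_zero_of_projective _)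
      (add_comm 1 n)
    have w (M : ModuleCat.{u} (EnvelopingAlgebra k A)) :
        (tensorRightMap S.f).app M ≫ (tensorRightMap S.g).app M = 0 :=
      ModuleCat.hom_ext (BimoduleTensor.linearMap_ext fun m w => by
        have : S.g (S.f w) = 0 := congrArg (fun f => f.hom w) S.zero
        exact (congrArg (BimoduleTensor.mk k A M S.X₃ m) this).trans (map_zero _))
    have hT := fun M => tensorRightMap_shortExact S hS M (w M)
    have e₁ : (hT (regularBimodule k A)).extClass.comp (Ext.mk₀ (tensorRegularIso S.X₁).hom)
        (add_zero 1) = (Ext.mk₀ (tensorRegularIso S.X₃).hom).comp hS.extClass (zero_add 1) :=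
      ShortComplex.ShortExact.extClass_naturality (hT (regularBimodule k A)) hS
        { τ₁ := (tensorRegularIso S.X₁).hom
          τ₂ := (tensorRegularIso S.X₂).hom
          τ₃ := (tensorRegularIso S.X₃).hom
          comm₁₂ := (tensorRegularIso_naturality S.f).symm
          comm₂₃ := (tensorRegularIso_naturality S.g).symm }
    have e₂ := Ext.mapExactFunctor_comp_extClass.{u, u} (tensorRightMap S.f) (tensorRightMap S.g)
      w hT x
    change (x.mapExactFunctor (tensorRight S.X₃) : Ext.{u} _ _ m).comp
      ((Ext.mk₀ (tensorRegularIso S.X₃).hom).comp (hS.extClass.comp z (add_comm 1 n)) _) _ =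
      (-1 : ℤ) ^ (m * (n + 1)) • ((Ext.mk₀ (tensorRegularIso S.X₃).hom).comp
        (hS.extClass.comp z (add_comm 1 n)) _).comp x _
    have e₃ : (Ext.mk₀ (tensorRegularIso S.X₃).hom).comp (hS.extClass.comp z (add_comm 1 n))
        (zero_add (n + 1)) = (hT (regularBimodule k A)).extClass.comp
          ((Ext.mk₀ (tensorRegularIso S.X₁).hom).comp z (zero_add n)) (add_comm 1 n) := by
      rw [← Ext.comp_assoc _ _ _ (zero_add 1) _ (by lia), ← e₁,
        Ext.comp_assoc _ _ _ (add_zero 1) (zero_add n) (by lia)]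
    rw [e₃, ← Ext.comp_assoc _ _ _ rfl (add_comm 1 n) (by lia), e₂, Ext.zsmul_comp,
      Ext.comp_assoc _ _ _ (add_comm 1 m) rfl (by lia), ih, Ext.comp_zsmul, smul_smul, ← pow_add,
      Ext.comp_assoc _ _ _ (add_comm 1 n) (add_comm n m) (by lia), mul_add, mul_one,
      add_comm m (m * n)]

/-- The Hochschild cohomology ring of a projective algebra is graded commutative: by
`tensorRight_comp_eq` for `W = A`, both products agree up to sign with that of `x ⊗_A A` and `y`. -/
theorem hochschild_gradedCommutative [Module.Projective k A] (m n : ℕ)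
    (x : Ext.{u} (regularBimodule k A) (regularBimodule k A) m)
    (y : Ext.{u} (regularBimodule k A) (regularBimodule k A) n) :
    x.comp y rfl = (-1 : ℤ) ^ (m * n) • y.comp x (add_comm n m) := by
  have e₁ := tensorRight_comp_eq x (regularBimodule k A) (Ext.mk₀ (𝟙 _))
  have e₂ := tensorRight_comp_eq x (regularBimodule k A) y
  rw [Ext.comp_mk₀_id, mul_zero, pow_zero, one_smul] at e₁
  have inj {p : ℕ} : Function.Injective
      fun z : Ext.{u} (regularBimodule k A) (regularBimodule k A) p =>
      (Ext.mk₀ (tensorRegularIso (regularBimodule k A)).hom).comp z (zero_add p) :=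
    Function.LeftInverse.injective
      (g := fun z => (Ext.mk₀ (tensorRegularIso (regularBimodule k A)).inv).comp z (zero_add p))
      fun z => by
        dsimp only
        rw [Ext.mk₀_comp_mk₀_assoc, Iso.inv_hom_id, Ext.mk₀_id_comp]
  apply inj
  dsimp only
  rw [Ext.comp_zsmul, ← Ext.comp_assoc _ _ _ (zero_add m) rfl (by lia),
    ← Ext.comp_assoc _ _ _ (zero_add n) (add_comm n m) (by lia), ← e₂, ← e₁,
    Ext.comp_assoc_of_second_deg_zero]

end GradedCommutativity

/-! ### The finiteness condition in terms of Noetherian modules -/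

section Criterion

variable {k : Type v} [CommRing k] {A : Type u} [Ring A] [Algebra k A]

instance : Module.Finite (EnvelopingAlgebra k A) (regularBimodule k A) :=
  .of_surjective ((LinearMap.id : EnvelopingAlgebra k A →ₗ[EnvelopingAlgebra k A] _).smulRight
      (regularEquiv k A 1)) fun x => by
    refine ⟨EnvelopingAlgebra.left k A ((regularEquiv k A).symm x), ?_⟩
    refine (regular_left_smul _ _).trans ?_
    rw [mul_one, AddEquiv.apply_symm_apply]

/-- For a projective algebra, **Fgb** says that all modules `Ext^*(A, X)` with `X` finitely
generated are Noetherian: graded commutativity turns right Noetherianity of the Hochschild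
cohomology ring into left Noetherianity. -/
theorem fgb_iff_isNoeth [Module.Projective k A] :
    Fgb k A ↔ ∀ X : ModuleCat.{u} (EnvelopingAlgebra k A), Module.Finite (EnvelopingAlgebra k A) X →
      ExtStar.IsNoeth.{u} (regularBimodule k A) X := by
  constructor
  · intro h X hX
    have := h.right_noetherian
    have := h.ext_finite X hX
    exact isNoetherian_of_isNoetherianRing_of_finite _ _
  · intro h
    have h₀ : IsNoetherian (HochschildCohomology k A)ᵐᵒᵖ (HochschildCohomology k A) :=
      h (regularBimodule k A) inferInstance
    have h₁ : IsNoetherianRing (HochschildCohomology k A)ᵐᵒᵖ := by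
      let e : HochschildCohomology k A ≃ₗ[(HochschildCohomology k A)ᵐᵒᵖ]
          (HochschildCohomology k A)ᵐᵒᵖ :=
        { opAddEquiv with map_smul' := fun _ _ => rfl }
      exact isNoetherian_of_linearEquiv e
    refine ⟨isNoetherianRing_of_ringEquiv _
      (ExtStar.equivOpposite hochschild_gradedCommutative).symm, h₁, fun X hX => ?_⟩
    have : IsNoetherian _ _ := h X hX
    exact Module.IsNoetherian.finite _ _

end Criterion

/-! ### Exact functors from restriction of scalars and matrices -/

section MonomialMatrix

variable {R ι : Type*} [Ring R] [DecidableEq ι]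

/-- The matrix with the entry `c i` at `(i, σ i)` for all `i`, and zero elsewhere. -/
def monomialMatrix (σ : ι → ι) (c : ι → R) : Matrix ι ι R :=
  Matrix.of fun i j => if σ i = j then c i else 0

theorem diagonal_eq_monomialMatrix (c : ι → R) :
    Matrix.diagonal c = monomialMatrix (fun i => i) c := rfl

theorem monomialMatrix_one : monomialMatrix (fun i => i) (fun _ => 1) = (1 : Matrix ι ι R) := rfl

theorem monomialMatrix_mul [Fintype ι] (σ τ : ι → ι) (c d : ι → R) :
    monomialMatrix σ c * monomialMatrix τ d =
      monomialMatrix (fun i => τ (σ i)) (fun i => c i * d (σ i)) := by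
  ext i j
  rw [Matrix.mul_apply, Fintype.sum_eq_single (σ i) fun x hx => by simp [monomialMatrix, hx.symm]]
  simp [monomialMatrix]

end MonomialMatrix

section Functors

open Limits

theorem ModuleCat.restrictScalars_exact {R S : Type u} [Ring R] [Ring S] (f : R →+* S) :
    PreservesFiniteLimits (ModuleCat.restrictScalars.{u} f) ∧
      PreservesFiniteColimits (ModuleCat.restrictScalars.{u} f) :=
  ((ModuleCat.restrictScalars.{u} f).exact_tfae.out 1 3).1 fun S h => by
    rw [ShortComplex.ShortExact.moduleCat_exact_iff_function_exact] at h ⊢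
    exact h

variable {k : Type v} [CommRing k] {R S : Type u} [Ring R] [Ring S] [Algebra k R] [Algebra k S]

/-- Restriction of scalars along a homomorphism of `k`-algebras. -/
def restrictFunctor (f : R →ₐ[k] S) : ModuleCat.{u} S ⥤ ModuleCat.{u} R :=
  ModuleCat.restrictScalars.{u} (f : R →+* S)

instance (f : R →ₐ[k] S) : (restrictFunctor f).Additive :=
  inferInstanceAs (ModuleCat.restrictScalars _).Additive

instance (f : R →ₐ[k] S) : PreservesFiniteLimits (restrictFunctor f) :=
  (ModuleCat.restrictScalars_exact _).1

instance (f : R →ₐ[k] S) : PreservesFiniteColimits (restrictFunctor f) :=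
  (ModuleCat.restrictScalars_exact _).2

/-- Restriction of scalars preserves finite generation if the larger algebra is finite over `k`,
because modules are then finitely generated over `k`. -/
theorem restrictFunctor_finite [Module.Finite k S] (f : R →ₐ[k] S) (M : ModuleCat.{u} S)
    [Module.Finite S M] : Module.Finite R ((restrictFunctor f).obj M) := by
  let : Module k M := Module.compHom M (algebraMap k S)
  let : Module R M := Module.compHom M (f : R →+* S)
  have : IsScalarTower k S M := ⟨fun c s m => by rw [Algebra.smul_def, mul_smul]; rfl⟩
  have : IsScalarTower k R M := ⟨fun c r m => by
    change f (c • r) • m = algebraMap k S c • f r • m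
    rw [map_smul, Algebra.smul_def, mul_smul]⟩
  have : Module.Finite k M := .trans S M
  have : Module.Finite R M := .of_restrictScalars_finite k R M
  exact this

variable {ι : Type u} [Fintype ι] [DecidableEq ι]

/-- The functor `X ↦ (ι → X)` from `R`-modules to `S`-modules, where `S` acts on functions through
matrices with entries in `R`. -/
def matrixFunctor (f : S →ₐ[k] Matrix ι ι R) : ModuleCat.{u} R ⥤ ModuleCat.{u} S :=
  ModuleCat.toMatrixModCat R ι ⋙ restrictFunctor f

instance (f : S →ₐ[k] Matrix ι ι R) : (matrixFunctor f).Additive where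
  map_add := rfl

section

variable [Nonempty ι]

theorem toMatrixModCat_isEquivalence : (ModuleCat.toMatrixModCat.{u, u, u} R ι).IsEquivalence :=
  (ModuleCat.matrixEquivalence R (Classical.arbitrary ι)).isEquivalence_functor

instance (f : S →ₐ[k] Matrix ι ι R) : PreservesFiniteLimits (matrixFunctor f) := by
  have := toMatrixModCat_isEquivalence (R := R) (ι := ι)
  exact comp_preservesFiniteLimits _ _

instance (f : S →ₐ[k] Matrix ι ι R) : PreservesFiniteColimits (matrixFunctor f) := by
  have := toMatrixModCat_isEquivalence (R := R) (ι := ι)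
  exact comp_preservesFiniteColimits _ _

end

open scoped Matrix.Module in
theorem matrixFunctor_finite [Module.Finite k R] (f : S →ₐ[k] Matrix ι ι R) (M : ModuleCat.{u} R)
    [Module.Finite R M] : Module.Finite S ((matrixFunctor f).obj M) := by
  have : Module.Finite k (Matrix ι ι R) := inferInstanceAs (Module.Finite k (ι → ι → R))
  have : Module.Finite (Matrix ι ι R) (ι → M) := .of_restrictScalars_finite R _ _
  have : Module.Finite (Matrix ι ι R) ((ModuleCat.toMatrixModCat R ι).obj M) := this
  exact restrictFunctor_finite f _

theorem matrixFunctor_smul_apply (f : S →ₐ[k] Matrix ι ι R) {M : ModuleCat.{u} R} {s : S}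
    {σ : ι → ι} {c : ι → R} (h : f s = monomialMatrix σ c) (x : (matrixFunctor f).obj M) (i : ι) :
    (s • x : ι → M) i = c i • (x : ι → M) (σ i) := by
  change ∑ j, f s i j • (x : ι → M) j = _
  simp [h, monomialMatrix, ite_smul]

end Functors

/-! ### Modules over a skew group algebra -/

section SkewModules

open Limits

namespace SkewMonoidAlgebra

variable (k E G : Type*) [CommRing k] [Ring E] [Algebra k E]

/-- The coefficients of an element of a skew monoid algebra, as a linear equivalence. -/
def coeffLinearEquivBase : SkewMonoidAlgebra E G ≃ₗ[k] (G →₀ E) :=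
  { coeffAddEquiv with map_smul' := coeff_smul }

theorem finite_of_finite [Finite G] [Module.Finite k E] :
    Module.Finite k (SkewMonoidAlgebra E G) :=
  .equiv (coeffLinearEquivBase k E G).symm

theorem projective_of_projective [Module.Projective k E] :
    Module.Projective k (SkewMonoidAlgebra E G) := by
  have : Module.Projective k (G →₀ E) := .finsupp
  exact .of_equiv' (coeffLinearEquivBase k E G).symm

end SkewMonoidAlgebra

namespace SkewMonoidAlgebra

section Lift

variable {k E S : Type*} [CommRing k] [Ring E] [Algebra k E] [Ring S] [Algebra k S]
  {G : Type*} [Group G] [MulSemiringAction G E] [SMulCommClass G k E]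
  (f : E →ₐ[k] S) (γ : G →* S) (h : ∀ (x : E) (y : G), f (y • x) * γ y = γ y * f x)

/-- The algebra homomorphism out of a skew group algebra given by homomorphisms on the coefficients
and on the group satisfying the commutation rule. -/
def liftAlgHom : SkewMonoidAlgebra E G →ₐ[k] S := liftNCAlgHom f γ (h _ _)

theorem liftAlgHom_single_one (e : E) : liftAlgHom f γ h (single 1 e) = f e :=
  (liftNC_single _ _ _ _).trans ((congrArg (f e * ·) (map_one γ)).trans (mul_one _))

theorem liftAlgHom_single (g : G) : liftAlgHom f γ h (single g 1) = γ g :=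
  (liftNC_single _ _ _ _).trans ((congrArg (· * γ g) (map_one f)).trans (one_mul _))

end Lift

variable {E : Type*} [Ring E] {G : Type*} [Group G] [MulSemiringAction G E]

theorem single_eq_mul (g : G) (e : E) :
    (single g e : SkewMonoidAlgebra E G) = single 1 e * single g 1 := by
  rw [single_mul_single, one_mul, one_smul, mul_one]

/-- Additive maps between modules over a skew group algebra are linear if they commute with the
actions of the coefficients and of the group. -/
def linearMap {M N : Type*} [AddCommGroup M] [AddCommGroup N] [Module (SkewMonoidAlgebra E G) M]
    [Module (SkewMonoidAlgebra E G) N] (f : M →+ N)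
    (h₁ : ∀ (e : E) m, f ((single 1 e : SkewMonoidAlgebra E G) • m) =
      (single 1 e : SkewMonoidAlgebra E G) • f m)
    (h₂ : ∀ (g : G) m, f ((single g 1 : SkewMonoidAlgebra E G) • m) =
      (single g 1 : SkewMonoidAlgebra E G) • f m) : M →ₗ[SkewMonoidAlgebra E G] N where
  __ := f
  map_smul' s m := by
    change f (s • m) = s • f m
    induction s using SkewMonoidAlgebra.induction_on with
    | zero => rw [zero_smul, zero_smul, map_zero]
    | single g e => rw [single_eq_mul, mul_smul, mul_smul, h₁, h₂]
    | add x y hx hy => rw [add_smul, add_smul, map_add, hx, hy]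

end SkewMonoidAlgebra

open SkewMonoidAlgebra

variable (k : Type v) [CommRing k] (E : Type u) [Ring E] [Algebra k E]
  (G : Type u) [Group G] [MulSemiringAction G E] [SMulCommClass G k E]

/-- The inclusion of the coefficient ring into a skew group algebra. -/
def coeffInclusion : E →ₐ[k] SkewMonoidAlgebra E G where
  __ := singleOneRingHom
  commutes' _ := rfl

variable [Fintype G]

section DecidableEqIndex

variable [DecidableEq G]

/-- The matrix description of coinduction from `E` to the skew group algebra `E ⋊ G`: on functions
`f : G → X`, `(e f)(x) = (x⁻¹ e) f(x)` and `(g f)(x) = f(g⁻¹ x)`. -/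
def coinductionMatrix : SkewMonoidAlgebra E G →ₐ[k] Matrix G G E :=
  liftAlgHom
    ((Matrix.diagonalAlgHom k).comp
      (AlgHom.pi fun x : G => MulSemiringAction.toAlgHom k E x⁻¹))
    { toFun g := monomialMatrix (fun x => g⁻¹ * x) fun _ => 1
      map_one' := by simp only [inv_one, one_mul, monomialMatrix_one]
      map_mul' g h := by simp only [monomialMatrix_mul, mul_inv_rev, mul_assoc, mul_one] }
    fun e g => by
      change Matrix.diagonal (fun x : G => x⁻¹ • g • e) * monomialMatrix _ _ =
        monomialMatrix _ _ * Matrix.diagonal (fun x : G => x⁻¹ • e)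
      simp [diagonal_eq_monomialMatrix, monomialMatrix_mul, mul_smul]

theorem coinductionMatrix_single_one (e : E) :
    coinductionMatrix k E G (single 1 e) = monomialMatrix (fun x => x) fun x => x⁻¹ • e := by
  rw [coinductionMatrix, liftAlgHom_single_one]; rfl

theorem coinductionMatrix_single (g : G) :
    coinductionMatrix k E G (single g 1) = monomialMatrix (fun x => g⁻¹ * x) fun _ => 1 := by
  rw [coinductionMatrix, liftAlgHom_single]; rfl

/-- Restriction from the skew group algebra `E ⋊ G` to `E`. -/
abbrev coeffRestriction : ModuleCat.{u} (SkewMonoidAlgebra E G) ⥤ ModuleCat.{u} E :=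
  restrictFunctor (coeffInclusion k E G)

/-- Coinduction from `E` to the skew group algebra `E ⋊ G`. -/
abbrev coinduction : ModuleCat.{u} E ⥤ ModuleCat.{u} (SkewMonoidAlgebra E G) :=
  matrixFunctor (coinductionMatrix k E G)

variable {k E G}

theorem coinduction_single_one_smul {X : ModuleCat.{u} E} (e : E)
    (f : (coinduction k E G).obj X) (x : G) :
    ((single 1 e : SkewMonoidAlgebra E G) • f : G → X) x = (x⁻¹ • e) • (f : G → X) x :=
  matrixFunctor_smul_apply _ (coinductionMatrix_single_one k E G e) f x

theorem coinduction_single_smul {X : ModuleCat.{u} E} (g : G)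
    (f : (coinduction k E G).obj X) (x : G) :
    ((single g 1 : SkewMonoidAlgebra E G) • f : G → X) x = (f : G → X) (g⁻¹ * x) :=
  (matrixFunctor_smul_apply _ (coinductionMatrix_single k E G g) f x).trans (one_smul _ _)

variable (k E G)

/-- The unit `Z → (G → Z)`, `z ↦ (x ↦ x⁻¹ z)`, of the adjunction between restriction and
coinduction. -/
def coinductionUnit : 𝟭 _ ⟶ coeffRestriction k E G ⋙ coinduction k E G where
  app Z := ModuleCat.ofHom (Y := (coinduction k E G).obj ((coeffRestriction k E G).obj Z)) <|
    SkewMonoidAlgebra.linearMap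
      (AddMonoidHom.mk' (fun z (x : G) => (single x⁻¹ 1 : SkewMonoidAlgebra E G) • z)
        fun y z => funext fun x => smul_add _ _ _)
      (fun e z => by
        funext x
        refine Eq.trans ?_ (coinduction_single_one_smul e _ x).symm
        change (single x⁻¹ 1 : SkewMonoidAlgebra E G) • (single 1 e : SkewMonoidAlgebra E G) • z =
          (single 1 (x⁻¹ • e) : SkewMonoidAlgebra E G) • (single x⁻¹ 1 : SkewMonoidAlgebra E G) • z
        simp [smul_smul, single_mul_single])
      (fun g z => by
        funext x
        refine Eq.trans ?_ (coinduction_single_smul g _ x).symm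
        change (single x⁻¹ 1 : SkewMonoidAlgebra E G) • (single g 1 : SkewMonoidAlgebra E G) • z =
          (single (g⁻¹ * x)⁻¹ 1 : SkewMonoidAlgebra E G) • z
        simp [smul_smul, single_mul_single])
  naturality Y Z f := ModuleCat.hom_ext <| LinearMap.ext fun z => funext fun x =>
    (f.hom.map_smul (single x⁻¹ 1 : SkewMonoidAlgebra E G) z).symm

/-- The counit `(G → X) → X`, `f ↦ f 1`, of the adjunction between restriction and coinduction. -/
def coinductionCounit : coinduction k E G ⋙ coeffRestriction k E G ⟶ 𝟭 _ where
  app X := ModuleCat.ofHom (X := (coeffRestriction k E G).obj ((coinduction k E G).obj X))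
    { toFun f := (f : G → X) 1
      map_add' _ _ := rfl
      map_smul' e f := by
        refine (coinduction_single_one_smul e _ 1).trans ?_
        rw [inv_one, one_smul]; rfl }
  naturality _ _ _ := rfl

theorem coinduction_triangle (Z : ModuleCat.{u} (SkewMonoidAlgebra E G)) :
    (coeffRestriction k E G).map ((coinductionUnit k E G).app Z) ≫
      (coinductionCounit k E G).app ((coeffRestriction k E G).obj Z) = 𝟙 _ := by
  refine ModuleCat.hom_ext <| LinearMap.ext fun z => ?_
  change (fun z : Z => (single (1 : G)⁻¹ 1 : SkewMonoidAlgebra E G) • z) z = z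
  rw [inv_one]
  exact one_smul (SkewMonoidAlgebra E G) (show Z from z)

end DecidableEqIndex

/-- The averaging map `(G → Z) → Z`, `f ↦ c ∑ x, x f(x)`. -/
def averageHom (c : k) (Z : Type*) [AddCommGroup Z] [Module (SkewMonoidAlgebra E G) Z] :
    (G → Z) →+ Z :=
  AddMonoidHom.mk' (fun f => algebraMap k (SkewMonoidAlgebra E G) c •
      ∑ x, (single x 1 : SkewMonoidAlgebra E G) • f x)
    fun f f' => by simp only [Pi.add_apply, smul_add, Finset.sum_add_distrib]

section Average

variable {k E G}
variable {Z : Type*} [AddCommGroup Z] [Module (SkewMonoidAlgebra E G) Z]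

theorem averageHom_apply (c : k) (f : G → Z) :
    averageHom k E G c Z f = algebraMap k (SkewMonoidAlgebra E G) c •
      ∑ x, (single x 1 : SkewMonoidAlgebra E G) • f x := rfl

theorem averageHom_coeff_smul (c : k) (e : E) (f : G → Z) :
    averageHom k E G c Z (fun x => (single 1 (x⁻¹ • e) : SkewMonoidAlgebra E G) • f x) =
      (single 1 e : SkewMonoidAlgebra E G) • averageHom k E G c Z f := by
  rw [averageHom_apply, averageHom_apply, smul_smul, ← Algebra.commutes c, mul_smul]
  refine congrArg _ ?_
  rw [Finset.smul_sum]
  exact Finset.sum_congr rfl fun x _ => by simp [smul_smul, single_mul_single]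

theorem averageHom_translate (c : k) (g : G) (f : G → Z) :
    averageHom k E G c Z (fun x => f (g⁻¹ * x)) =
      (single g 1 : SkewMonoidAlgebra E G) • averageHom k E G c Z f := by
  rw [averageHom_apply, averageHom_apply, smul_smul, ← Algebra.commutes c, mul_smul]
  refine congrArg _ ?_
  rw [Finset.smul_sum, ← Equiv.sum_comp (Equiv.mulLeft g)]
  exact Finset.sum_congr rfl fun x _ => by simp [smul_smul, single_mul_single]

theorem averageHom_orbit {c : k} (hc : c * Nat.card G = 1) (z : Z) :
    averageHom k E G c Z (fun x => (single x⁻¹ 1 : SkewMonoidAlgebra E G) • z) = z := by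
  have h (x : G) : (single x 1 : SkewMonoidAlgebra E G) •
      (single x⁻¹ 1 : SkewMonoidAlgebra E G) • z = z := by
    rw [smul_smul, single_mul_single, mul_inv_cancel, smul_one, one_mul]
    exact one_smul _ z
  rw [averageHom_apply]
  simp only [h, Finset.sum_const, Finset.card_univ]
  rw [← Nat.cast_smul_eq_nsmul (SkewMonoidAlgebra E G), smul_smul, ← map_natCast (algebraMap k _),
    ← map_mul, ← Nat.card_eq_fintype_card, hc, map_one, one_smul]

end Average

variable [DecidableEq G]

/-- The averaging map `(G → Z) → Z`, `f ↦ c ∑ x, x f(x)`, as a natural transformation. -/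
def coinductionAverage (c : k) : coeffRestriction k E G ⋙ coinduction k E G ⟶ 𝟭 _ where
  app Z := ModuleCat.ofHom (X := (coinduction k E G).obj ((coeffRestriction k E G).obj Z)) <|
    SkewMonoidAlgebra.linearMap (averageHom k E G c Z)
      (fun e f => (congrArg (averageHom k E G c Z)
        (funext (coinduction_single_one_smul e f))).trans (averageHom_coeff_smul c e _))
      (fun g f => (congrArg (averageHom k E G c Z)
        (funext (coinduction_single_smul g f))).trans (averageHom_translate c g _))
  naturality Y Z f := ModuleCat.hom_ext <| LinearMap.ext fun (φ : G → Y) => by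
    change averageHom k E G c Z (fun x => f.hom (φ x)) = f.hom (averageHom k E G c Y φ)
    rw [averageHom_apply, averageHom_apply, map_smul, _root_.map_sum]
    simp only [map_smul]

/-- If `|G|` is invertible with inverse `c`, averaging exhibits the identity as a retract of
coinduction after restriction. -/
theorem coinduction_retract {c : k} (hc : c * Nat.card G = 1) :
    coinductionUnit k E G ≫ coinductionAverage k E G c = 𝟙 _ :=
  NatTrans.ext <| funext fun Z => ModuleCat.hom_ext <| LinearMap.ext fun z =>
    averageHom_orbit (Z := Z) hc z

end SkewModules

/-! ### The diagonal skew group algebra of the enveloping algebra -/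

section Diagonal

open SkewMonoidAlgebra

variable (k : Type v) [CommRing k] (A : Type u) [Ring A] [Algebra k A]
  (G : Type u) [Group G] [MulSemiringAction G A] [SMulCommClass G k A]

namespace EnvelopingAlgebra

variable {G} in
/-- The algebra endomorphism `a ⊗ b ↦ g a ⊗ g b` of the enveloping algebra. -/
def diagonalMap (g : G) : EnvelopingAlgebra k A →ₐ[k] EnvelopingAlgebra k A :=
  Algebra.TensorProduct.map (MulSemiringAction.toAlgHom k A g)
    (AlgHom.op (MulSemiringAction.toAlgHom k A g))

variable {k A G} in
theorem diagonalMap_tmul (g : G) (a : A) (b : Aᵐᵒᵖ) :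
    diagonalMap k A g (a ⊗ₜ b) = (g • a) ⊗ₜ op (g • b.unop) := rfl

end EnvelopingAlgebra

open EnvelopingAlgebra

/-- The enveloping algebra of `A`, on which a group acting on `A` acts diagonally. It is a type
synonym, because a tensor product already carries the action on its first factor. -/
def DiagonalEnveloping : Type u := EnvelopingAlgebra k A

namespace DiagonalEnveloping

instance : Ring (DiagonalEnveloping k A) := inferInstanceAs (Ring (EnvelopingAlgebra k A))

instance : Algebra k (DiagonalEnveloping k A) :=
  inferInstanceAs (Algebra k (EnvelopingAlgebra k A))

instance [Module.Finite k A] : Module.Finite k (DiagonalEnveloping k A) := by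
  have : Module.Finite k Aᵐᵒᵖ := .equiv (opLinearEquiv k)
  exact inferInstanceAs (Module.Finite k (A ⊗[k] Aᵐᵒᵖ))

instance : MulSemiringAction G (DiagonalEnveloping k A) where
  smul g e := diagonalMap k A g e
  one_smul e := by
    change diagonalMap k A 1 e = e
    induction e using TensorProduct.induction_on with
    | zero => exact map_zero _
    | add x y hx hy => rw [map_add, hx, hy]
    | tmul a b => rw [diagonalMap_tmul, one_smul, one_smul, op_unop]
  mul_smul g h e := by
    change diagonalMap k A (g * h) e = diagonalMap k A g (diagonalMap k A h e)
    induction e using TensorProduct.induction_on with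
    | zero => rw [map_zero, map_zero, map_zero]
    | add x y hx hy => rw [map_add, hx, hy, map_add, map_add]
    | tmul a b =>
      rw [diagonalMap_tmul, diagonalMap_tmul, diagonalMap_tmul, mul_smul, unop_op, mul_smul]
  smul_zero g := map_zero (diagonalMap k A g)
  smul_add g := map_add (diagonalMap k A g)
  smul_one g := map_one (diagonalMap k A g)
  smul_mul g := map_mul (diagonalMap k A g)

instance : SMulCommClass G k (DiagonalEnveloping k A) :=
  ⟨fun g c e => map_smul (diagonalMap k A g) c e⟩

/-- The pure tensor `a ⊗ b`. -/
def tmul (a : A) (b : Aᵐᵒᵖ) : DiagonalEnveloping k A := (a ⊗ₜ b : EnvelopingAlgebra k A)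

variable {k A}

theorem induction_on {P : DiagonalEnveloping k A → Prop} (e : DiagonalEnveloping k A)
    (zero : P 0) (tmul : ∀ a b, P (tmul k A a b)) (add : ∀ x y, P x → P y → P (x + y)) : P e :=
  TensorProduct.induction_on e zero tmul add

theorem tmul_mul_tmul (a a' : A) (b b' : Aᵐᵒᵖ) :
    tmul k A a b * tmul k A a' b' = tmul k A (a * a') (b * b') :=
  Algebra.TensorProduct.tmul_mul_tmul a a' b b'

variable {G} in
theorem smul_tmul (g : G) (a : A) (b : Aᵐᵒᵖ) :
    g • tmul k A a b = tmul k A (g • a) (op (g • b.unop)) := rfl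

end DiagonalEnveloping

open DiagonalEnveloping

/-- The skew group algebra of `G` acting diagonally on the enveloping algebra of `A`. -/
abbrev DiagonalAlgebra : Type u := SkewMonoidAlgebra (DiagonalEnveloping k A) G

namespace DiagonalAlgebra

/-- The inclusion of the group. -/
def ofGroup : G →* DiagonalAlgebra k A G where
  toFun g := single g 1
  map_one' := rfl
  map_mul' g h := by rw [single_mul_single, smul_one, one_mul]

/-- Left multiplication by elements of `A`. -/
def left : A →ₐ[k] DiagonalAlgebra k A G :=
  (coeffInclusion k (DiagonalEnveloping k A) G).comp
    (Algebra.TensorProduct.includeLeft : A →ₐ[k] EnvelopingAlgebra k A)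

/-- Right multiplication by elements of `A`. -/
def right : Aᵐᵒᵖ →ₐ[k] DiagonalAlgebra k A G :=
  (coeffInclusion k (DiagonalEnveloping k A) G).comp
    (Algebra.TensorProduct.includeRight : Aᵐᵒᵖ →ₐ[k] EnvelopingAlgebra k A)

variable {k A G}

theorem left_apply (a : A) : left k A G a = single 1 (tmul k A a 1) := rfl

theorem right_apply (b : Aᵐᵒᵖ) : right k A G b = single 1 (tmul k A 1 b) := rfl

theorem ofGroup_apply (g : G) : ofGroup k A G g = single g 1 := rfl

theorem left_mul_right (a : A) (b : Aᵐᵒᵖ) :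
    left k A G a * right k A G b = single 1 (tmul k A a b) := by
  rw [left_apply, right_apply, single_mul_single, one_smul, tmul_mul_tmul, mul_one, one_mul,
    mul_one]

theorem commute_left_right (a : A) (b : Aᵐᵒᵖ) : Commute (left k A G a) (right k A G b) := by
  refine (left_mul_right a b).trans (Eq.symm ?_)
  rw [left_apply, right_apply, single_mul_single, one_smul, tmul_mul_tmul, mul_one, one_mul,
    mul_one]

theorem ofGroup_mul_left (g : G) (a : A) :
    ofGroup k A G g * left k A G a = left k A G (g • a) * ofGroup k A G g := by
  rw [ofGroup_apply, left_apply, left_apply, single_mul_single, single_mul_single, one_mul,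
    mul_one, smul_one, mul_one, one_mul, smul_tmul, unop_one, smul_one, op_one]

theorem ofGroup_mul_right (g : G) (b : Aᵐᵒᵖ) :
    ofGroup k A G g * right k A G b = right k A G (op (g • b.unop)) * ofGroup k A G g := by
  rw [ofGroup_apply, right_apply, right_apply, single_mul_single, single_mul_single, one_mul,
    mul_one, smul_one, mul_one, one_mul, smul_tmul, smul_one]

/-- Additive maps between modules over the diagonal skew group algebra are linear if they commute
with the left and right multiplications and with the group. -/
def linearMap {M N : Type*} [AddCommGroup M] [AddCommGroup N] [Module (DiagonalAlgebra k A G) M]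
    [Module (DiagonalAlgebra k A G) N] (f : M →+ N)
    (hl : ∀ a m, f (left k A G a • m) = left k A G a • f m)
    (hr : ∀ b m, f (right k A G b • m) = right k A G b • f m)
    (hg : ∀ g m, f (ofGroup k A G g • m) = ofGroup k A G g • f m) :
    M →ₗ[DiagonalAlgebra k A G] N :=
  SkewMonoidAlgebra.linearMap f
    (fun e m => by
      induction e using DiagonalEnveloping.induction_on with
      | zero => rw [single_zero, zero_smul, zero_smul, map_zero]
      | add x y hx hy => rw [single_add, add_smul, add_smul, map_add, hx, hy]
      | tmul a b => rw [← left_mul_right, mul_smul, mul_smul, hl, hr])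
    hg

end DiagonalAlgebra

end Diagonal

/-! ### Induction and restriction between the diagonal algebra and bimodules over `A ⋊ G` -/

section Induction

open SkewMonoidAlgebra DiagonalEnveloping

variable (k : Type v) [CommRing k] (A : Type u) [Ring A] [Algebra k A]
  (G : Type u) [Group G] [MulSemiringAction G A] [SMulCommClass G k A]

/-- The homomorphism of enveloping algebras induced by the inclusion of `A` in `A ⋊ G`. -/
def envelopingInclusion :
    DiagonalEnveloping k A →ₐ[k] EnvelopingAlgebra k (SkewMonoidAlgebra A G) :=
  (Algebra.TensorProduct.map (coeffInclusion k A G) (AlgHom.op (coeffInclusion k A G)) :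
    EnvelopingAlgebra k A →ₐ[k] EnvelopingAlgebra k (SkewMonoidAlgebra A G))

variable {k A} in
theorem envelopingInclusion_tmul (a : A) (b : Aᵐᵒᵖ) : envelopingInclusion k A G (tmul k A a b) =
    single 1 a ⊗ₜ op (single 1 b.unop) := rfl

/-- The homomorphism from the diagonal skew group algebra to the enveloping algebra of `A ⋊ G`
through which `a ⊗ b` acts by `m ↦ a m b` and `g` by `m ↦ g m g⁻¹`. -/
def diagonalInclusion : DiagonalAlgebra k A G →ₐ[k] EnvelopingAlgebra k (SkewMonoidAlgebra A G) :=
  liftAlgHom (envelopingInclusion k A G)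
    { toFun g := single g 1 ⊗ₜ op (single g⁻¹ 1)
      map_one' := by rw [inv_one]; rfl
      map_mul' g h := by
        rw [Algebra.TensorProduct.tmul_mul_tmul, single_mul_single, ← op_mul, single_mul_single]
        simp }
    fun e g => by
      simp only [MonoidHom.coe_mk, OneHom.coe_mk]
      induction e using DiagonalEnveloping.induction_on with
      | zero => rw [smul_zero, map_zero, zero_mul, mul_zero]
      | add x y hx hy => rw [smul_add, map_add, map_add, add_mul, mul_add, hx, hy]
      | tmul a b =>
        rw [smul_tmul, envelopingInclusion_tmul, envelopingInclusion_tmul, unop_op,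
          Algebra.TensorProduct.tmul_mul_tmul, Algebra.TensorProduct.tmul_mul_tmul, ← op_mul,
          ← op_mul]
        simp [single_mul_single]

theorem diagonalInclusion_left (a : A) :
    diagonalInclusion k A G (DiagonalAlgebra.left k A G a) =
      EnvelopingAlgebra.left k _ (single 1 a) := by
  rw [DiagonalAlgebra.left_apply, diagonalInclusion, liftAlgHom_single_one]; rfl

theorem diagonalInclusion_right (b : Aᵐᵒᵖ) :
    diagonalInclusion k A G (DiagonalAlgebra.right k A G b) =
      EnvelopingAlgebra.right k _ (op (single 1 b.unop)) := by
  rw [DiagonalAlgebra.right_apply, diagonalInclusion, liftAlgHom_single_one]; rfl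

theorem diagonalInclusion_ofGroup (g : G) :
    diagonalInclusion k A G (DiagonalAlgebra.ofGroup k A G g) =
      EnvelopingAlgebra.left k _ (single g 1) *
        EnvelopingAlgebra.right k _ (op (single g⁻¹ 1)) := by
  rw [DiagonalAlgebra.ofGroup_apply, diagonalInclusion, liftAlgHom_single,
    EnvelopingAlgebra.left_mul_right]
  rfl

variable [Fintype G] [DecidableEq G]

open DiagonalAlgebra

/-- The left action of `A ⋊ G` on functions `f : G → Z`: `(a f)(x) = a f(x)` and
`(g f)(x) = g f(g⁻¹ x)`. -/
def inductionLeft : SkewMonoidAlgebra A G →ₐ[k] Matrix G G (DiagonalAlgebra k A G) :=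
  liftAlgHom
    ((Matrix.diagonalAlgHom k).comp (AlgHom.pi fun _ : G => left k A G))
    { toFun g := monomialMatrix (fun x => g⁻¹ * x) fun _ => ofGroup k A G g
      map_one' := by simp only [inv_one, one_mul, map_one, monomialMatrix_one]
      map_mul' g h := by simp only [monomialMatrix_mul, mul_inv_rev, mul_assoc, map_mul] }
    fun a g => by
      change Matrix.diagonal (fun _ : G => left k A G (g • a)) * monomialMatrix _ _ =
        monomialMatrix _ _ * Matrix.diagonal (fun _ : G => left k A G a)
      simp only [diagonal_eq_monomialMatrix, monomialMatrix_mul, ofGroup_mul_left]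

theorem inductionLeft_single_one (a : A) :
    inductionLeft k A G (single 1 a) = monomialMatrix (fun x => x) fun _ => left k A G a := by
  rw [inductionLeft, liftAlgHom_single_one]; rfl

theorem inductionLeft_single (g : G) : inductionLeft k A G (single g 1) =
    monomialMatrix (fun x => g⁻¹ * x) fun _ => ofGroup k A G g := by
  rw [inductionLeft, liftAlgHom_single]; rfl

/-- The right action of `A ⋊ G` on functions `f : G → Z`: `(f a)(x) = f(x) (x a)` and
`(f h)(x) = f(x h⁻¹)`. -/
def inductionRight : (SkewMonoidAlgebra A G)ᵐᵒᵖ →ₐ[k] Matrix G G (DiagonalAlgebra k A G) :=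
  AlgHom.opComm <| liftAlgHom
    (AlgHom.opComm.symm <| (Matrix.diagonalAlgHom k).comp <| AlgHom.pi fun x : G =>
      (right k A G).comp (AlgHom.op (MulSemiringAction.toAlgHom k A x)))
    { toFun h := op (monomialMatrix (fun x => x * h⁻¹) fun _ => 1)
      map_one' := by simp only [inv_one, mul_one, monomialMatrix_one, op_one]
      map_mul' g h := by
        simp only [← op_mul, monomialMatrix_mul, mul_inv_rev, mul_assoc, mul_one] }
    fun a h => unop_injective <| by
      change monomialMatrix (fun x => x * h⁻¹) (fun _ => 1) *
          Matrix.diagonal (fun x : G => right k A G (op (x • h • a))) =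
        Matrix.diagonal (fun x : G => right k A G (op (x • a))) *
          monomialMatrix (fun x => x * h⁻¹) (fun _ => 1)
      simp only [diagonal_eq_monomialMatrix, monomialMatrix_mul, smul_smul, inv_mul_cancel_right,
        one_mul, mul_one]

theorem inductionRight_single_one (a : A) : inductionRight k A G (op (single 1 a)) =
    monomialMatrix (fun x => x) fun x => right k A G (op (x • a)) := by
  rw [inductionRight, AlgHom.opComm_apply_apply, unop_op, liftAlgHom_single_one]; rfl

theorem inductionRight_single (h : G) : inductionRight k A G (op (single h 1)) =
    monomialMatrix (fun x => x * h⁻¹) fun _ => 1 := by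
  rw [inductionRight, AlgHom.opComm_apply_apply, unop_op, liftAlgHom_single]; rfl

theorem inductionLeft_commute_inductionRight (s : SkewMonoidAlgebra A G)
    (t : (SkewMonoidAlgebra A G)ᵐᵒᵖ) :
    Commute (inductionLeft k A G s) (inductionRight k A G t) := by
  induction s using SkewMonoidAlgebra.induction_on with
  | zero => rw [map_zero]; exact Commute.zero_left _
  | add x y hx hy => rw [map_add]; exact hx.add_left hy
  | single g a =>
    obtain ⟨t, rfl⟩ := op_surjective t
    induction t using SkewMonoidAlgebra.induction_on with
    | zero => rw [MulOpposite.op_zero, map_zero]; exact Commute.zero_right _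
    | add x y hx hy => rw [MulOpposite.op_add, map_add]; exact hx.add_right hy
    | single h b =>
      rw [single_eq_mul g a, single_eq_mul h b, op_mul, map_mul, map_mul]
      refine Commute.mul_left (Commute.mul_right ?_ ?_) (Commute.mul_right ?_ ?_)
      · rw [inductionLeft_single_one, inductionRight_single, commute_iff_eq, monomialMatrix_mul,
          monomialMatrix_mul]
        simp only [one_mul, mul_one]
      · rw [inductionLeft_single_one, inductionRight_single_one, commute_iff_eq,
          monomialMatrix_mul, monomialMatrix_mul]
        simp only [(commute_left_right _ _).eq]
      · rw [inductionLeft_single, inductionRight_single, commute_iff_eq, monomialMatrix_mul,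
          monomialMatrix_mul]
        simp only [one_mul, mul_one, mul_assoc]
      · rw [inductionLeft_single, inductionRight_single_one, commute_iff_eq, monomialMatrix_mul,
          monomialMatrix_mul]
        simp only [ofGroup_mul_right, unop_op, smul_smul, mul_inv_cancel_left]

/-- The matrix description of induction from the diagonal skew group algebra to bimodules over
`A ⋊ G`. -/
def inductionMatrix : EnvelopingAlgebra k (SkewMonoidAlgebra A G) →ₐ[k]
    Matrix G G (DiagonalAlgebra k A G) :=
  Algebra.TensorProduct.lift (inductionLeft k A G) (inductionRight k A G)
    (inductionLeft_commute_inductionRight k A G)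

theorem inductionMatrix_left (s : SkewMonoidAlgebra A G) :
    inductionMatrix k A G (EnvelopingAlgebra.left k _ s) = inductionLeft k A G s :=
  (Algebra.TensorProduct.lift_tmul ..).trans ((congrArg _ (map_one _)).trans (mul_one _))

theorem inductionMatrix_right (t : (SkewMonoidAlgebra A G)ᵐᵒᵖ) :
    inductionMatrix k A G (EnvelopingAlgebra.right k _ t) = inductionRight k A G t :=
  (Algebra.TensorProduct.lift_tmul ..).trans ((congrArg (· * _) (map_one _)).trans (one_mul _))

/-- Restriction of bimodules over `A ⋊ G` to the diagonal skew group algebra. -/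
abbrev diagonalRestriction : ModuleCat.{u} (EnvelopingAlgebra k (SkewMonoidAlgebra A G)) ⥤
    ModuleCat.{u} (DiagonalAlgebra k A G) :=
  restrictFunctor (diagonalInclusion k A G)

/-- Induction from the diagonal skew group algebra to bimodules over `A ⋊ G`. The induced bimodule
`Z ⋊ G` is modelled by functions `f : G → Z`, with `f` standing for `∑ x, f(x) x`. -/
abbrev bimoduleInduction : ModuleCat.{u} (DiagonalAlgebra k A G) ⥤
    ModuleCat.{u} (EnvelopingAlgebra k (SkewMonoidAlgebra A G)) :=
  matrixFunctor (inductionMatrix k A G)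

end Induction

/-! ### The adjunction between induction and restriction -/

section InductionAdjunction

open SkewMonoidAlgebra DiagonalEnveloping DiagonalAlgebra

/-- Additive maps between bimodules over `A ⋊ G` are linear if they commute with the left and right
actions of `A` and of `G`. -/
def skewBimoduleLinearMap {k : Type*} [CommRing k] {A : Type*} [Ring A] [Algebra k A]
    {G : Type*} [Group G] [MulSemiringAction G A] [SMulCommClass G k A]
    {M N : Type*} [AddCommGroup M] [AddCommGroup N]
    [Module (EnvelopingAlgebra k (SkewMonoidAlgebra A G)) M]
    [Module (EnvelopingAlgebra k (SkewMonoidAlgebra A G)) N] (f : M →+ N)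
    (hl : ∀ a m, f (EnvelopingAlgebra.left k (SkewMonoidAlgebra A G) (single 1 a) • m) =
      EnvelopingAlgebra.left k (SkewMonoidAlgebra A G) (single 1 a) • f m)
    (hlg : ∀ g m, f (EnvelopingAlgebra.left k (SkewMonoidAlgebra A G) (single g 1) • m) =
      EnvelopingAlgebra.left k (SkewMonoidAlgebra A G) (single g 1) • f m)
    (hr : ∀ a m, f (EnvelopingAlgebra.right k (SkewMonoidAlgebra A G) (op (single 1 a)) • m) =
      EnvelopingAlgebra.right k (SkewMonoidAlgebra A G) (op (single 1 a)) • f m)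
    (hrg : ∀ g m, f (EnvelopingAlgebra.right k (SkewMonoidAlgebra A G) (op (single g 1)) • m) =
      EnvelopingAlgebra.right k (SkewMonoidAlgebra A G) (op (single g 1)) • f m) :
    M →ₗ[EnvelopingAlgebra k (SkewMonoidAlgebra A G)] N :=
  EnvelopingAlgebra.linearMap f
    (fun s m => by
      induction s using SkewMonoidAlgebra.induction_on with
      | zero =>
        rw [map_zero]
        exact (congrArg f (zero_smul (EnvelopingAlgebra k (SkewMonoidAlgebra A G)) m)).trans
          ((map_zero f).trans
            (zero_smul (EnvelopingAlgebra k (SkewMonoidAlgebra A G)) (f m)).symm)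
      | add x y hx hy => rw [map_add, add_smul, add_smul, map_add, hx, hy]
      | single g a => rw [single_eq_mul, map_mul, mul_smul, mul_smul, hl, hlg])
    (fun s m => by
      obtain ⟨s, rfl⟩ := op_surjective s
      induction s using SkewMonoidAlgebra.induction_on with
      | zero =>
        rw [MulOpposite.op_zero, map_zero]
        exact (congrArg f (zero_smul (EnvelopingAlgebra k (SkewMonoidAlgebra A G)) m)).trans
          ((map_zero f).trans
            (zero_smul (EnvelopingAlgebra k (SkewMonoidAlgebra A G)) (f m)).symm)
      | add x y hx hy =>
        rw [MulOpposite.op_add, map_add, add_smul, add_smul, map_add, hx, hy]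
      | single g a => rw [single_eq_mul, op_mul, map_mul, mul_smul, mul_smul, hrg, hr])

variable {k : Type v} [CommRing k] {A : Type u} [Ring A] [Algebra k A]
  {G : Type u} [Group G] [MulSemiringAction G A] [SMulCommClass G k A]

section RestrictedAction

variable (Y : ModuleCat.{u} (EnvelopingAlgebra k (SkewMonoidAlgebra A G)))

/-- A bimodule over `A ⋊ G` and its restriction to the diagonal skew group algebra have the same
underlying additive group. -/
def restrictionEquiv : (diagonalRestriction k A G).obj Y ≃+ Y := AddEquiv.refl Y

variable {Y}

theorem restrictionEquiv_left_smul (a : A) (y : (diagonalRestriction k A G).obj Y) :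
    restrictionEquiv Y (left k A G a • y) =
      EnvelopingAlgebra.left k (SkewMonoidAlgebra A G) (single 1 a) • restrictionEquiv Y y :=
  congrArg (· • restrictionEquiv Y y) (diagonalInclusion_left k A G a)

theorem restrictionEquiv_right_smul (b : Aᵐᵒᵖ) (y : (diagonalRestriction k A G).obj Y) :
    restrictionEquiv Y (right k A G b • y) =
      EnvelopingAlgebra.right k (SkewMonoidAlgebra A G) (op (single 1 b.unop)) •
        restrictionEquiv Y y :=
  congrArg (· • restrictionEquiv Y y) (diagonalInclusion_right k A G b)

theorem restrictionEquiv_group_smul (g : G) (y : (diagonalRestriction k A G).obj Y) :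
    restrictionEquiv Y (ofGroup k A G g • y) =
      EnvelopingAlgebra.left k (SkewMonoidAlgebra A G) (single g 1) •
        EnvelopingAlgebra.right k (SkewMonoidAlgebra A G) (op (single g⁻¹ 1)) •
          restrictionEquiv Y y :=
  (congrArg (· • restrictionEquiv Y y) (diagonalInclusion_ofGroup k A G g)).trans (mul_smul _ _ _)

end RestrictedAction

variable [Fintype G]

variable (k A G) in
/-- The map `(G → Y) → Y`, `f ↦ ∑ x, f(x) x`, for a bimodule `Y` over `A ⋊ G`. -/
def inductionSum (Y : Type*) [AddCommGroup Y]
    [Module (EnvelopingAlgebra k (SkewMonoidAlgebra A G)) Y] : (G → Y) →+ Y :=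
  AddMonoidHom.mk'
    (fun f => ∑ x, EnvelopingAlgebra.right k (SkewMonoidAlgebra A G) (op (single x 1)) • f x)
    fun f f' => by simp only [Pi.add_apply, smul_add, Finset.sum_add_distrib]

section InductionSum

variable {Y : Type*} [AddCommGroup Y]
  [Module (EnvelopingAlgebra k (SkewMonoidAlgebra A G)) Y] (f : G → Y)

theorem inductionSum_apply : inductionSum k A G Y f =
    ∑ x, EnvelopingAlgebra.right k (SkewMonoidAlgebra A G) (op (single x 1)) • f x := rfl

theorem inductionSum_left (a : SkewMonoidAlgebra A G) :
    inductionSum k A G Y (fun x => EnvelopingAlgebra.left k _ a • f x) =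
      EnvelopingAlgebra.left k _ a • inductionSum k A G Y f := by
  simp only [inductionSum_apply, Finset.smul_sum, EnvelopingAlgebra.smul_right_comm]

theorem inductionSum_left_group (g : G) :
    inductionSum k A G Y (fun x => EnvelopingAlgebra.left k (SkewMonoidAlgebra A G) (single g 1) •
      EnvelopingAlgebra.right k (SkewMonoidAlgebra A G) (op (single g⁻¹ 1)) • f (g⁻¹ * x)) =
      EnvelopingAlgebra.left k (SkewMonoidAlgebra A G) (single g 1) • inductionSum k A G Y f := by
  rw [inductionSum_left]
  refine congrArg _ ?_
  rw [inductionSum_apply, inductionSum_apply, ← Equiv.sum_comp (Equiv.mulLeft g)]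
  refine Finset.sum_congr rfl fun x _ => ?_
  rw [smul_smul, ← map_mul, ← op_mul, single_mul_single]
  simp

theorem inductionSum_right (a : A) :
    inductionSum k A G Y (fun x => EnvelopingAlgebra.right k (SkewMonoidAlgebra A G)
      (op (single 1 (x • a))) • f x) =
      EnvelopingAlgebra.right k (SkewMonoidAlgebra A G) (op (single 1 a)) •
        inductionSum k A G Y f := by
  rw [inductionSum_apply, inductionSum_apply, Finset.smul_sum]
  refine Finset.sum_congr rfl fun x _ => ?_
  rw [smul_smul, smul_smul, ← map_mul, ← map_mul, ← op_mul, ← op_mul, single_mul_single,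
    single_mul_single]
  simp

theorem inductionSum_right_group (h : G) :
    inductionSum k A G Y (fun x => f (x * h⁻¹)) =
      EnvelopingAlgebra.right k (SkewMonoidAlgebra A G) (op (single h 1)) •
        inductionSum k A G Y f := by
  rw [inductionSum_apply, inductionSum_apply, Finset.smul_sum,
    ← Equiv.sum_comp (Equiv.mulRight h)]
  refine Finset.sum_congr rfl fun x _ => ?_
  rw [smul_smul, ← map_mul, ← op_mul, single_mul_single]
  simp

end InductionSum

variable [DecidableEq G]

section Action

variable {Z : ModuleCat.{u} (DiagonalAlgebra k A G)} (f : (bimoduleInduction k A G).obj Z) (x : G)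

theorem induction_left_smul (a : A) :
    (EnvelopingAlgebra.left k (SkewMonoidAlgebra A G) (single 1 a) • f : G → Z) x =
      left k A G a • (f : G → Z) x :=
  matrixFunctor_smul_apply _
    ((inductionMatrix_left k A G _).trans (inductionLeft_single_one k A G a)) f x

theorem induction_left_group_smul (g : G) :
    (EnvelopingAlgebra.left k (SkewMonoidAlgebra A G) (single g 1) • f : G → Z) x =
      ofGroup k A G g • (f : G → Z) (g⁻¹ * x) :=
  matrixFunctor_smul_apply _
    ((inductionMatrix_left k A G _).trans (inductionLeft_single k A G g)) f x

theorem induction_right_smul (a : A) :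
    (EnvelopingAlgebra.right k (SkewMonoidAlgebra A G) (op (single 1 a)) • f : G → Z) x =
      right k A G (op (x • a)) • (f : G → Z) x :=
  matrixFunctor_smul_apply _
    ((inductionMatrix_right k A G _).trans (inductionRight_single_one k A G a)) f x

theorem induction_right_group_smul (h : G) :
    (EnvelopingAlgebra.right k (SkewMonoidAlgebra A G) (op (single h 1)) • f : G → Z) x =
      (f : G → Z) (x * h⁻¹) :=
  (matrixFunctor_smul_apply _
    ((inductionMatrix_right k A G _).trans (inductionRight_single k A G h)) f x).trans
    (one_smul _ _)

end Action

section RestrictedInductionAction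

variable {Z : ModuleCat.{u} (DiagonalAlgebra k A G)}
  (f : (diagonalRestriction k A G).obj ((bimoduleInduction k A G).obj Z)) (x : G)

theorem restricted_induction_left_smul (a : A) :
    (left k A G a • f : G → Z) x = left k A G a • (f : G → Z) x :=
  (congrFun (restrictionEquiv_left_smul a f) x).trans (induction_left_smul _ _ _)

theorem restricted_induction_right_smul (b : Aᵐᵒᵖ) :
    (right k A G b • f : G → Z) x = right k A G (op (x • b.unop)) • (f : G → Z) x :=
  (congrFun (restrictionEquiv_right_smul b f) x).trans (induction_right_smul _ _ _)

theorem restricted_induction_group_smul (g : G) :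
    (ofGroup k A G g • f : G → Z) x = ofGroup k A G g • (f : G → Z) (g⁻¹ * x * g) := by
  refine (congrFun (restrictionEquiv_group_smul g f) x).trans
    ((induction_left_group_smul _ _ _).trans
      (congrArg _ ((induction_right_group_smul (Z := Z) _ _ _).trans ?_)))
  rw [inv_inv]
  rfl

end RestrictedInductionAction

variable (k A G)

/-- The unit `Z → (G → Z)`, placing an element of `Z` at the identity of `G`. -/
def inductionUnit : 𝟭 _ ⟶ bimoduleInduction k A G ⋙ diagonalRestriction k A G where
  app Z := ModuleCat.ofHom (Y := (diagonalRestriction k A G).obj ((bimoduleInduction k A G).obj Z))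
    (DiagonalAlgebra.linearMap (AddMonoidHom.single (fun _ : G => (Z : Type u)) 1)
      (fun a z => funext fun x => by
        refine Eq.trans ?_ (restricted_induction_left_smul _ x a).symm
        change (Pi.single 1 _ : G → Z) x = _ • (Pi.single 1 z : G → Z) x
        obtain rfl | hx := eq_or_ne x 1
        · rw [Pi.single_eq_same, Pi.single_eq_same]
        · rw [Pi.single_eq_of_ne hx, Pi.single_eq_of_ne hx, smul_zero])
      (fun b z => funext fun x => by
        refine Eq.trans ?_ (restricted_induction_right_smul _ x b).symm
        change (Pi.single 1 _ : G → Z) x = _ • (Pi.single 1 z : G → Z) x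
        obtain rfl | hx := eq_or_ne x 1
        · rw [Pi.single_eq_same, Pi.single_eq_same, one_smul, op_unop]
        · rw [Pi.single_eq_of_ne hx, Pi.single_eq_of_ne hx, smul_zero])
      (fun g z => funext fun x => by
        refine Eq.trans ?_ (restricted_induction_group_smul _ x g).symm
        change (Pi.single 1 _ : G → Z) x = _ • (Pi.single 1 z : G → Z) (g⁻¹ * x * g)
        obtain rfl | hx := eq_or_ne x 1
        · rw [mul_one, inv_mul_cancel, Pi.single_eq_same, Pi.single_eq_same]
        · rw [Pi.single_eq_of_ne hx, Pi.single_eq_of_ne, smul_zero]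
          intro h
          apply hx
          rwa [mul_eq_one_iff_eq_inv, mul_eq_left] at h))
  naturality Y Z f := ModuleCat.hom_ext <| LinearMap.ext fun z => funext fun x =>
    (Pi.apply_single (fun _ : G => f.hom) (fun _ => map_zero _) 1 z x).symm

/-- The projection `(G → Z) → Z` onto the component at the identity of `G`. -/
def inductionProjection : bimoduleInduction k A G ⋙ diagonalRestriction k A G ⟶ 𝟭 _ where
  app Z := ModuleCat.ofHom (X := (diagonalRestriction k A G).obj ((bimoduleInduction k A G).obj Z))
    (DiagonalAlgebra.linearMap (Pi.evalAddMonoidHom (fun _ : G => (Z : Type u)) 1)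
      (fun a f => restricted_induction_left_smul f 1 a)
      (fun b f => (restricted_induction_right_smul f 1 b).trans (by rw [one_smul, op_unop]; rfl))
      (fun g f => (restricted_induction_group_smul f 1 g).trans (by
        rw [mul_one, inv_mul_cancel]; rfl)))
  naturality _ _ _ := rfl

theorem induction_retract : inductionUnit k A G ≫ inductionProjection k A G = 𝟙 _ :=
  NatTrans.ext <| funext fun Z => ModuleCat.hom_ext <| LinearMap.ext fun z =>
    Pi.single_eq_same (M := fun _ : G => (Z : Type u)) 1 z

/-- The counit `(G → Y) → Y`, `f ↦ ∑ x, f(x) x`, of the adjunction between induction and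
restriction. -/
def inductionCounit : diagonalRestriction k A G ⋙ bimoduleInduction k A G ⟶ 𝟭 _ where
  app Y := ModuleCat.ofHom (X := (bimoduleInduction k A G).obj ((diagonalRestriction k A G).obj Y))
    (skewBimoduleLinearMap (inductionSum k A G Y)
      (fun a f => (congrArg (inductionSum k A G Y) (funext fun x =>
        (induction_left_smul f x a).trans (restrictionEquiv_left_smul a _))).trans
          (inductionSum_left _ _))
      (fun g f => (congrArg (inductionSum k A G Y) (funext fun x =>
        (induction_left_group_smul f x g).trans (restrictionEquiv_group_smul g _))).trans
          (inductionSum_left_group _ _))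
      (fun a f => (congrArg (inductionSum k A G Y) (funext fun x =>
        (induction_right_smul f x a).trans (restrictionEquiv_right_smul (op (x • a)) _))).trans
          (inductionSum_right _ _))
      (fun h f => (congrArg (inductionSum k A G Y) (funext fun x =>
        induction_right_group_smul f x h)).trans (inductionSum_right_group _ _)))
  naturality Y Y' g := ModuleCat.hom_ext <| LinearMap.ext fun (φ : G → Y) => by
    change inductionSum k A G Y' (fun x => g.hom (φ x)) = g.hom (inductionSum k A G Y φ)
    rw [inductionSum_apply, inductionSum_apply, _root_.map_sum]
    simp only [map_smul]

theorem induction_triangle (Z : ModuleCat.{u} (DiagonalAlgebra k A G)) :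
    (bimoduleInduction k A G).map ((inductionUnit k A G).app Z) ≫
      (inductionCounit k A G).app ((bimoduleInduction k A G).obj Z) = 𝟙 _ := by
  refine ModuleCat.hom_ext <| LinearMap.ext fun (f : G → Z) => funext fun y => ?_
  change inductionSum k A G ((bimoduleInduction k A G).obj Z)
    (fun x => (Pi.single 1 (f x) : G → Z)) y = f y
  refine (Finset.sum_apply (M := fun _ : G => (Z : Type u)) y _ _).trans ?_
  refine (Fintype.sum_eq_single y fun x hx => ?_).trans ?_
  · refine (induction_right_group_smul (Z := Z) _ y x).trans
      (Pi.single_eq_of_ne (M := fun _ : G => (Z : Type u)) ?_ _)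
    rwa [Ne, mul_inv_eq_one, eq_comm]
  · refine (induction_right_group_smul (Z := Z) _ y y).trans ?_
    rw [mul_inv_cancel]
    exact Pi.single_eq_same (M := fun _ : G => (Z : Type u)) 1 (f y)

end InductionAdjunction

/-! ### The regular bimodules of `A` and of `A ⋊ G` -/

section Regular

open SkewMonoidAlgebra DiagonalEnveloping DiagonalAlgebra

variable (k : Type v) [CommRing k] (A : Type u) [Ring A] [Algebra k A]
  (G : Type u) [Group G] [MulSemiringAction G A] [SMulCommClass G k A]

/-- The action of the enveloping algebra on the regular bimodule. -/
def regularAction : DiagonalEnveloping k A →ₐ[k] Module.End k A :=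
  (Algebra.TensorProduct.lift (Algebra.lsmul k k A) (Algebra.lsmul k k A) fun a b =>
    LinearMap.ext fun x => smul_comm a b x : EnvelopingAlgebra k A →ₐ[k] Module.End k A)

variable {k A} in
theorem regularAction_tmul (a x : A) (b : Aᵐᵒᵖ) :
    regularAction k A (tmul k A a b) x = a * (x * b.unop) :=
  LinearMap.congr_fun (Algebra.TensorProduct.lift_tmul ..) x

/-- The action of the diagonal skew group algebra on `A`: the enveloping algebra acts by
multiplications on both sides, and `G` by automorphisms. -/
def diagonalRegularAction : DiagonalAlgebra k A G →ₐ[k] Module.End k A :=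
  liftAlgHom (regularAction k A) (DistribMulAction.toModuleEnd k A) fun e g => by
    ext x
    change regularAction k A (g • e) (g • x) = g • regularAction k A e x
    induction e using DiagonalEnveloping.induction_on with
    | zero => rw [smul_zero, map_zero, LinearMap.zero_apply, LinearMap.zero_apply, smul_zero]
    | add y z hy hz =>
      rw [smul_add, map_add, map_add, LinearMap.add_apply, LinearMap.add_apply, hy, hz, smul_add]
    | tmul a b => rw [smul_tmul, regularAction_tmul, regularAction_tmul, unop_op, smul_mul',
        smul_mul']

/-- The algebra `A` as a module over the diagonal skew group algebra. -/
def diagonalRegular : ModuleCat.{u} (DiagonalAlgebra k A G) :=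
  letI : Module (DiagonalAlgebra k A G) A :=
    Module.compHom A (diagonalRegularAction k A G : DiagonalAlgebra k A G →+* Module.End k A)
  ModuleCat.of (DiagonalAlgebra k A G) A

/-- The underlying additive group of `diagonalRegular`. -/
def diagonalRegularEquiv : A ≃+ diagonalRegular k A G := AddEquiv.refl A

variable {k A G}

theorem diagonalRegular_smul (s : DiagonalAlgebra k A G) (x : A) :
    s • diagonalRegularEquiv k A G x =
      diagonalRegularEquiv k A G (diagonalRegularAction k A G s x) := rfl

theorem diagonalRegular_coeff_smul (e : DiagonalEnveloping k A) (x : A) :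
    (single 1 e : DiagonalAlgebra k A G) • diagonalRegularEquiv k A G x =
      diagonalRegularEquiv k A G (regularAction k A e x) := by
  rw [diagonalRegular_smul, diagonalRegularAction, liftAlgHom_single_one]

theorem diagonalRegular_left_smul (a x : A) :
    left k A G a • diagonalRegularEquiv k A G x = diagonalRegularEquiv k A G (a * x) := by
  rw [left_apply, diagonalRegular_coeff_smul, regularAction_tmul, unop_one, mul_one]

theorem diagonalRegular_right_smul (b : Aᵐᵒᵖ) (x : A) :
    right k A G b • diagonalRegularEquiv k A G x = diagonalRegularEquiv k A G (x * b.unop) := by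
  rw [right_apply, diagonalRegular_coeff_smul, regularAction_tmul, one_mul]

theorem diagonalRegular_group_smul (g : G) (x : A) :
    ofGroup k A G g • diagonalRegularEquiv k A G x = diagonalRegularEquiv k A G (g • x) := by
  rw [ofGroup_apply, diagonalRegular_smul, diagonalRegularAction, liftAlgHom_single]
  rfl

variable (k A G)

/-- The regular bimodule, as a module over `DiagonalEnveloping k A`. -/
def regularModule : ModuleCat.{u} (DiagonalEnveloping k A) := regularBimodule k A

/-- The identity of `A`, as a linear map from the restriction of `diagonalRegular` to the regular
bimodule. -/
def coeffRestrictionRegularMap :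
    (coeffRestriction k (DiagonalEnveloping k A) G).obj (diagonalRegular k A G) →ₗ[
      DiagonalEnveloping k A] regularModule k A :=
  { ((diagonalRegularEquiv k A G).symm.trans (regularEquiv k A)).toAddMonoidHom with
    map_smul' := fun e x => by
      obtain ⟨x, rfl⟩ := (diagonalRegularEquiv k A G).surjective x
      refine (congrArg (fun y => regularEquiv k A ((diagonalRegularEquiv k A G).symm y))
        (diagonalRegular_coeff_smul e x)).trans ?_
      rw [AddEquiv.symm_apply_apply]
      change regularEquiv k A (regularAction k A e x) =
        (show EnvelopingAlgebra k A from e) • regularEquiv k A x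
      induction e using DiagonalEnveloping.induction_on with
      | zero => exact (zero_smul (EnvelopingAlgebra k A) (regularEquiv k A x)).symm
      | add e e' he he' =>
        rw [map_add, LinearMap.add_apply, map_add, he, he']
        exact (add_smul (R := EnvelopingAlgebra k A) e e' (regularEquiv k A x)).symm
      | tmul a b => exact congrArg (regularEquiv k A) (regularAction_tmul a x b) }

/-- Restricting `A` from the diagonal skew group algebra to the enveloping algebra gives the
regular bimodule. -/
def coeffRestrictionDiagonalRegularIso :
    (coeffRestriction k (DiagonalEnveloping k A) G).obj (diagonalRegular k A G) ≅
      regularModule k A :=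
  LinearEquiv.toModuleIso (LinearEquiv.ofBijective (coeffRestrictionRegularMap k A G)
    ((diagonalRegularEquiv k A G).symm.trans (regularEquiv k A)).bijective)

variable [Fintype G] [DecidableEq G]

/-- The additive equivalence sending an element of `A ⋊ G` to its coefficient function. -/
def inductionRegularEquiv : regularBimodule k (SkewMonoidAlgebra A G) ≃+
    (bimoduleInduction k A G).obj (diagonalRegular k A G) :=
  (regularEquiv k (SkewMonoidAlgebra A G)).symm.trans
    ((coeffAddEquiv.trans (Finsupp.linearEquivFunOnFinite ℕ A G).toAddEquiv).trans
      (AddEquiv.piCongrRight fun _ : G => diagonalRegularEquiv k A G))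

variable {A G} in
theorem inductionRegularEquiv_apply (s : SkewMonoidAlgebra A G) (x : G) :
    (inductionRegularEquiv k A G (regularEquiv k _ s) : G → diagonalRegular k A G) x =
      diagonalRegularEquiv k A G (s.coeff x) := rfl

/-- The coefficient function, as a bimodule map. -/
def inductionRegularMap : regularBimodule k (SkewMonoidAlgebra A G)
    →ₗ[EnvelopingAlgebra k (SkewMonoidAlgebra A G)]
      (bimoduleInduction k A G).obj (diagonalRegular k A G) :=
  skewBimoduleLinearMap (inductionRegularEquiv k A G).toAddMonoidHom
    (fun a m => by
      obtain ⟨s, rfl⟩ := (regularEquiv k _).surjective m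
      funext x
      rw [regular_left_smul]
      refine (inductionRegularEquiv_apply k _ x).trans
        (Eq.trans ?_ (induction_left_smul _ x a).symm)
      refine Eq.trans ?_ (congrArg _ (inductionRegularEquiv_apply k s x)).symm
      rw [diagonalRegular_left_smul, coeff_single_mul, inv_one, one_mul, one_smul])
    (fun g m => by
      obtain ⟨s, rfl⟩ := (regularEquiv k _).surjective m
      funext x
      rw [regular_left_smul]
      refine (inductionRegularEquiv_apply k _ x).trans
        (Eq.trans ?_ (induction_left_group_smul _ x g).symm)
      refine Eq.trans ?_ (congrArg _ (inductionRegularEquiv_apply k s _)).symm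
      rw [diagonalRegular_group_smul, coeff_single_mul, one_mul])
    (fun a m => by
      obtain ⟨s, rfl⟩ := (regularEquiv k _).surjective m
      funext x
      rw [regular_right_smul]
      refine (inductionRegularEquiv_apply k _ x).trans
        (Eq.trans ?_ (induction_right_smul _ x a).symm)
      refine Eq.trans ?_ (congrArg _ (inductionRegularEquiv_apply k s x)).symm
      rw [diagonalRegular_right_smul, unop_op, unop_op, coeff_mul_single, inv_one, mul_one])
    (fun g m => by
      obtain ⟨s, rfl⟩ := (regularEquiv k _).surjective m
      funext x
      rw [regular_right_smul]
      refine (inductionRegularEquiv_apply k _ x).trans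
        (Eq.trans ?_ (induction_right_group_smul _ x g).symm)
      refine Eq.trans ?_ (inductionRegularEquiv_apply k s _).symm
      rw [unop_op, coeff_mul_single, smul_one, mul_one])

/-- Inducing `A` from the diagonal skew group algebra gives the regular bimodule of `A ⋊ G`. -/
def inductionDiagonalRegularIso :
    regularBimodule k (SkewMonoidAlgebra A G) ≅
      (bimoduleInduction k A G).obj (diagonalRegular k A G) :=
  LinearEquiv.toModuleIso
    (LinearEquiv.ofBijective (inductionRegularMap k A G) (inductionRegularEquiv k A G).bijective)

end Regular

/-! ### Transfer of the finiteness condition -/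

section Transfer

variable {k : Type v} [CommRing k] {A : Type u} [Ring A] [Algebra k A] [Module.Finite k A]
  {G : Type u} [Group G] [MulSemiringAction G A] [SMulCommClass G k A] [Fintype G] [DecidableEq G]

instance : Module.Finite k (DiagonalAlgebra k A G) := SkewMonoidAlgebra.finite_of_finite k _ G

instance : Module.Finite k (EnvelopingAlgebra k (SkewMonoidAlgebra A G)) := by
  have : Module.Finite k (SkewMonoidAlgebra A G) := SkewMonoidAlgebra.finite_of_finite k A G
  have : Module.Finite k (SkewMonoidAlgebra A G)ᵐᵒᵖ := .equiv (opLinearEquiv k)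
  exact inferInstanceAs (Module.Finite k (_ ⊗[k] _))

variable (k A G) in
/-- The finiteness condition for the module `A` over the diagonal skew group algebra, which mediates
between those for `A` and for `A ⋊ G`. -/
def DiagonalFiniteness : Prop :=
  ∀ Z : ModuleCat.{u} (DiagonalAlgebra k A G), Module.Finite (DiagonalAlgebra k A G) Z →
    ExtStar.IsNoeth.{u} (diagonalRegular k A G) Z

variable [Module.Projective k A]

theorem fgb_skew_iff_diagonalFiniteness :
    Fgb k (SkewMonoidAlgebra A G) ↔ DiagonalFiniteness k A G := by
  have : Module.Projective k (SkewMonoidAlgebra A G) :=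
    SkewMonoidAlgebra.projective_of_projective k A G
  rw [fgb_iff_isNoeth]
  constructor
  · intro h Z hZ
    exact .of_retract (bimoduleInduction k A G) (diagonalRestriction k A G) (inductionUnit k A G)
      (inductionProjection k A G) (induction_retract k A G)
      ((h _ (matrixFunctor_finite _ Z)).of_iso (inductionDiagonalRegularIso k A G))
  · intro h Y hY
    exact .of_iso (inductionDiagonalRegularIso k A G).symm
      (.of_adjunction (bimoduleInduction k A G) (diagonalRestriction k A G) (inductionUnit k A G)
        (inductionCounit k A G) (induction_triangle k A G _) (h _ (restrictFunctor_finite _ Y)))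

theorem fgb_of_diagonalFiniteness (h : DiagonalFiniteness k A G) : Fgb k A := by
  rw [fgb_iff_isNoeth]
  intro (X : ModuleCat.{u} (DiagonalEnveloping k A)) (hX : Module.Finite (DiagonalEnveloping k A) X)
  exact .of_iso (coeffRestrictionDiagonalRegularIso k A G)
    (.of_adjunction (coeffRestriction k (DiagonalEnveloping k A) G)
      (coinduction k (DiagonalEnveloping k A) G) (coinductionUnit k _ G) (coinductionCounit k _ G)
      (coinduction_triangle k _ G _) (h _ (matrixFunctor_finite _ X)))

theorem diagonalFiniteness_of_fgb (hG : IsUnit (Nat.card G : k)) (h : Fgb k A) :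
    DiagonalFiniteness k A G := by
  rw [fgb_iff_isNoeth] at h
  obtain ⟨c, hc⟩ := hG.exists_left_inv
  intro Z hZ
  have hZ' : ExtStar.IsNoeth.{u} (regularModule k A)
      ((coeffRestriction k (DiagonalEnveloping k A) G).obj Z) :=
    h _ (restrictFunctor_finite (coeffInclusion k (DiagonalEnveloping k A) G) Z)
  exact .of_retract (coeffRestriction k (DiagonalEnveloping k A) G)
    (coinduction k (DiagonalEnveloping k A) G) (coinductionUnit k _ G)
    (coinductionAverage k _ G c) (coinduction_retract k _ G hc)
    (hZ'.of_iso (coeffRestrictionDiagonalRegularIso k A G).symm)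

end Transfer

end

theorem theorem4p1
    (k : Type v) [CommRing k] [IsNoetherianRing k]
    (A : Type u) [Ring A] [Algebra k A] [Module.Finite k A] [Module.Projective k A]
    (G : Type u) [Group G] [Finite G] [MulSemiringAction G A] [SMulCommClass G k A] :
    (Fgb k (SkewMonoidAlgebra A G) → Fgb k A) ∧
      (IsUnit (Nat.card G : k) → (Fgb k A ↔ Fgb k (SkewMonoidAlgebra A G))) := by
  classical
  have := Fintype.ofFinite G
  have descend (h : Fgb k (SkewMonoidAlgebra A G)) : Fgb k A :=
    fgb_of_diagonalFiniteness (fgb_skew_iff_diagonalFiniteness.1 h)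
  exact ⟨descend, fun hG =>
    ⟨fun h => fgb_skew_iff_diagonalFiniteness.2 (diagonalFiniteness_of_fgb hG h), descend⟩⟩
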